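/- **Setting.** Let $E$ be a real Hilbert space with norm $\|\cdot\|_2$, and let $Q\subset E$ be nonempty, closed, convex and bounded. Let $\|\cdot\|$ be a norm on $E$ with $a\|x\|_2\le\|x\|$ for some $a>0$, and let $\|g\|_*=\sup\{\langle g,x\rangle:\|x\|\le 1\}$ be its dual norm. Let $d$ be a prox-function on $Q$: lower semicontinuous and bounded above on $Q$, and $1$-strongly convex on $Q$ with respect to $\|\cdot\|$. The prox-diameter $R$ of $Q$ is defined by $R^2=\sup_Q d-\inf_Q d$. In the Euclidean case the norm is $\|\cdot\|_2$, $d(x)=\frac12\|x-x_0\|_2^2$ for a point $x_0\in E$, and $R$ and $L_\nu$ are written $R_2$ and $L_{\nu,2}$. **Problems and oracle.** The problem is to minimize over $Q$ a convex function $f$ with (sub)gradient field $\nabla f$ on $Q$ such that, with some constants $L_\nu\in[0,\infty]$, $\nu\in[0,1]$, $$\|\nabla f(x)-\nabla f(y)\|_*\le L_\nu\|x-y\|^\nu\qquad(x,y\in Q)$$ ($L_\nu=\infty$ means that nothing is required for this $\nu$). The deterministic oracle of inexactness $\delta\ge 0$ returns, at a point $x\in Q$, a pair $(F(x),G(x))$,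 where for all $x,y\in Q$ and all $\nu\in[0,1]$ with $L_\nu<\infty$ $$\frac{\mu}{2}\|y-x\|^2\le f(y)-F(x)-\langle G(x),y-x\rangle\le\frac{L_\nu}{1+\nu}\|y-x\|^{1+\nu}+\delta ,$$ with $\mu=0$ in part 1 and $\mu=\mu_2$ in part 2. (The exact oracle $F=f$, $G=\nabla f$ satisfies this with $\mu=0$, $\delta=0$.) A method chooses each query point in $Q$, and after each number of iterations its approximate solution in $Q$, as a function of the oracle's previous answers. One iteration is one oracle call. **Theorem.** There are absolute constants $C,c>0$ such that in every such setting the following two statements hold. 1. There is a family of methods with parameters $p\in[0,1]$ and $\varepsilon>0$ (depending on $E,Q,\|\cdot\|,d$, but not on $f$, the oracle, $\delta$, $\nu$ or the $L_\nu$) such that, with $$N_1(\varepsilon)=\max\Big\{1,\ \inf_{\nu\in[0,1]}\Big(\frac{L_\nu R^{1+\nu}}{\varepsilon}\Big)^{\frac{2}{1+2p\nu+\nu}}\Big\},$$ for every $f$, every family $(L_\nu)$ and every oracle as above with $\mu=0$ and $\delta\le c\,\varepsilon/N_1(\varepsilon)^p$, after any number $n\ge C\,N_1(\varepsilon)$ of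 iterations the approximate solution $x_n\in Q$ satisfies $f(x_n)-\inf_Q f\le\varepsilon$. 2. In the Euclidean case there is a family of methods with parameters $p\in[0,1]$, $\varepsilon>0$, $\mu_2>0$ (depending on $E,Q,x_0$, but not on $f$, the oracle, $\delta$, $\nu$ or the $L_{\nu,2}$) such that, with $$N_2(\varepsilon)=\max\Big\{1,\ \inf_{\nu\in[0,1]}\Big(\frac{L_{\nu,2}^{\,2/(1+\nu)}}{\mu_2\,\varepsilon^{(1-\nu)/(1+\nu)}}\Big)^{\frac{1+\nu}{1+2p\nu+\nu}}\cdot\max\Big\{1,\Big\lceil\ln\frac{\mu_2R_2^2}{\varepsilon}\Big\rceil\Big\}\Big\},$$ for every $\mu_2$-strongly convex $f$, every family $(L_{\nu,2})$ and every oracle as above with $\mu=\mu_2$ and $\delta\le c\,\varepsilon/N_2(\varepsilon)^p$, after any number $n\ge C\,N_2(\varepsilon)$ of iterations the approximate solution $x_n\in Q$ satisfies $f(x_n)-\inf_Q f\le\varepsilon$. (In $N_2$ read $\ln 0=0$ if $R_2=0$.) -/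

import Mathlib

open scoped ENNReal NNReal InnerProductSpace

noncomputable section

namespace UniversalMethods

variable {E : Type*} [NormedAddCommGroup E] [InnerProductSpace ℝ E]

/-! ### Geometry: dual norm and prox-structure

The Hilbert norm of `E` is `‖·‖`; the working norm is a (semi)norm `nrm` on `E`. -/

/-- The dual norm `‖g‖_* = sup {⟨g, x⟩ : ‖x‖ ≤ 1}` of the working norm. -/
def dualNorm (nrm : Seminorm ℝ E) (g : E) : ℝ :=
  sSup {r : ℝ | ∃ x : E, nrm x ≤ 1 ∧ r = ⟪g, x⟫_ℝ}

/-- `d` is a prox-function (distance generating function) on `Q` for the norm `nrm`: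
lower semicontinuous, bounded above and strongly convex on `Q` with modulus `1` with respect to
`nrm`. (On a closed convex set of a Hilbert space it is then also bounded below.) -/
structure IsProxFunction (nrm : Seminorm ℝ E) (Q : Set E) (d : E → ℝ) : Prop where
  lsc : LowerSemicontinuousOn d Q
  bddAbove : BddAbove (d '' Q)
  strong : ∀ x ∈ Q, ∀ y ∈ Q, ∀ a b : ℝ, 0 ≤ a → 0 ≤ b → a + b = 1 →
    d (a • x + b • y) ≤ a * d x + b * d y - a * b / 2 * nrm (x - y) ^ 2

/-- The prox-diameter `R` of `Q`: `R² = sup_Q d - inf_Q d`. -/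
def proxDiam (Q : Set E) (d : E → ℝ) : ℝ :=
  √(sSup (d '' Q) - sInf (d '' Q))

/-- The Euclidean prox-function centred at `x₀`. -/
def euclideanProx (x₀ : E) (x : E) : ℝ := ‖x - x₀‖ ^ 2 / 2

/-! ### Problems with Hölder gradient and inexact oracles -/

/-- `f` is a convex function on `Q` with (sub)gradient field `f'`, and for every `ν ∈ [0, 1]` the
Hölder condition `‖f' x - f' y‖_* ≤ L_ν ‖x - y‖ ^ ν` holds on `Q`; `L_ν = ∞` means that no
condition is imposed for this `ν`.
(For `ν = 0` the function may be nonsmooth and `f'` is a choice of subgradients.) -/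
structure IsHolderProblem (nrm : Seminorm ℝ E) (Q : Set E) (L : ℝ → ℝ≥0∞)
    (f : E → ℝ) (f' : E → E) : Prop where
  subgradient : ∀ x ∈ Q, ∀ y ∈ Q, f x + ⟪f' x, y - x⟫_ℝ ≤ f y
  holder : ∀ ν ∈ Set.Icc (0 : ℝ) 1, L ν ≠ ∞ → ∀ x ∈ Q, ∀ y ∈ Q,
    dualNorm nrm (f' x - f' y) ≤ (L ν).toReal * nrm (x - y) ^ ν

/-- The deterministic inexact oracle: at the point `x` it returns the pair `(F x, G x)`, and
`μ/2 ‖y - x‖² ≤ f y - F x - ⟨G x, y - x⟩ ≤ L_ν/(1+ν) ‖y - x‖^(1+ν) + δ` for all `x, y ∈ Q` and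
all `ν ∈ [0, 1]` with finite `L_ν`. For `ν = 1` this is the `(δ, L)`-oracle. -/
structure IsInexactOracle (nrm : Seminorm ℝ E) (Q : Set E) (μ δ : ℝ) (L : ℝ → ℝ≥0∞)
    (f : E → ℝ) (F : E → ℝ) (G : E → E) : Prop where
  lower : ∀ x ∈ Q, ∀ y ∈ Q, μ / 2 * nrm (y - x) ^ 2 ≤ f y - F x - ⟪G x, y - x⟫_ℝ
  upper : ∀ ν ∈ Set.Icc (0 : ℝ) 1, L ν ≠ ∞ → ∀ x ∈ Q, ∀ y ∈ Q,
    f y - F x - ⟪G x, y - x⟫_ℝ ≤ (L ν).toReal / (1 + ν) * nrm (y - x) ^ (1 + ν) + δ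

/-- `⟨g, x⟩ ≤ ‖g‖_* ‖x‖`, if the working norm dominates a multiple of the Hilbert norm. -/
theorem inner_le_dualNorm_mul (nrm : Seminorm ℝ E) {a : ℝ} (ha : 0 < a)
    (hn : ∀ x, a * ‖x‖ ≤ nrm x) (g x : E) : ⟪g, x⟫_ℝ ≤ dualNorm nrm g * nrm x := by
  have hb : BddAbove {r : ℝ | ∃ x : E, nrm x ≤ 1 ∧ r = ⟪g, x⟫_ℝ} := by
    refine ⟨‖g‖ * (1 / a), ?_⟩
    rintro r ⟨x, hx, rfl⟩
    refine (real_inner_le_norm g x).trans (mul_le_mul_of_nonneg_left ?_ (norm_nonneg _))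
    rw [le_div_iff₀ ha]
    linarith [hn x, mul_comm a ‖x‖]
  rcases (apply_nonneg nrm x).eq_or_lt with h | h
  · have h1 := hn x
    rw [← h] at h1
    have h2 : x = 0 := norm_le_zero_iff.1 (by nlinarith [norm_nonneg x])
    simp [h2]
  · have h1 : ⟪g, (nrm x)⁻¹ • x⟫_ℝ ≤ dualNorm nrm g := by
      refine le_csSup hb ⟨_, ?_, rfl⟩
      rw [map_smul_eq_mul, Real.norm_eq_abs, abs_of_pos (inv_pos.2 h), inv_mul_cancel₀ h.ne']
    rw [inner_smul_right] at h1
    rw [← div_le_iff₀ h, div_eq_inv_mul]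
    exact h1

/-- The exact oracle `(f, f')` of a problem with Hölder gradient is an inexact oracle with
`δ = 0`. -/
theorem IsHolderProblem.exactOracle {nrm : Seminorm ℝ E} {Q : Set E} {L : ℝ → ℝ≥0∞}
    {f : E → ℝ} {f' : E → E} (hQ : Convex ℝ Q) {a : ℝ} (ha : 0 < a) (hn : ∀ x, a * ‖x‖ ≤ nrm x)
    (h : IsHolderProblem nrm Q L f f') : IsInexactOracle nrm Q 0 0 L f f f' := by
  refine ⟨fun x hx y hy => by linarith [h.subgradient x hx y hy], fun ν hν hL x hx y hy => ?_⟩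
  set l := (L ν).toReal
  set r := nrm (y - x) with hr
  have hr0 : 0 ≤ r := apply_nonneg nrm _
  have hl0 : 0 ≤ l := ENNReal.toReal_nonneg
  have hν0 : (0 : ℝ) < 1 + ν := by linarith [hν.1]
  have hrr : r ^ ν * r = r ^ (1 + ν) := by
    rcases hr0.eq_or_lt with h0 | h0
    · rw [← h0, mul_zero, Real.zero_rpow hν0.ne']
    · rw [add_comm, Real.rpow_add_one h0.ne']
  -- telescoping sum over a uniform partition of the segment
  have key : ∀ n : ℕ, 0 < n → ∀ k : ℕ, k ≤ n →
      f (x + ((k : ℝ) / n) • (y - x)) - f x - (k / n : ℝ) * ⟪f' x, y - x⟫_ℝ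
        ≤ l * r ^ (1 + ν) * (((k : ℝ) / n) ^ (1 + ν) / (1 + ν) + ((k : ℝ) / n) ^ ν / n) := by
    intro n hn0 k
    have hnR : (0 : ℝ) < n := by exact_mod_cast hn0
    have mem : ∀ j : ℕ, j ≤ n → x + ((j : ℝ) / n) • (y - x) ∈ Q := fun j hj =>
      hQ.add_smul_sub_mem hx hy ⟨by positivity, by
        rw [div_le_one hnR]; exact_mod_cast hj⟩
    induction k with
    | zero =>
      intro _
      simp only [Nat.cast_zero, zero_div, zero_smul, add_zero, sub_self, zero_mul]
      positivity
    | succ k ih =>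
      intro hk
      have ih := ih (by omega)
      set s : ℝ := (k : ℝ) / n with hs
      set t : ℝ := ((k + 1 : ℕ) : ℝ) / n with ht
      have hst : t = s + 1 / n := by rw [ht, hs]; push_cast; ring
      have hs0 : 0 ≤ s := by positivity
      have hn1 : (0 : ℝ) < 1 / n := by positivity
      have ht0 : 0 < t := by linarith
      have h1 := h.subgradient _ (mem (k + 1) hk) _ (mem k (by omega))
      have e1 : x + s • (y - x) - (x + t • (y - x)) = (-(1 / n : ℝ)) • (y - x) := by
        rw [hst]; module
      rw [← hs, ← ht, e1, inner_smul_right] at h1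
      have h2 : ⟪f' (x + t • (y - x)) - f' x, y - x⟫_ℝ ≤ l * (t * r) ^ ν * r := by
        refine (inner_le_dualNorm_mul nrm ha hn _ _).trans ?_
        refine mul_le_mul_of_nonneg_right ?_ hr0
        refine (h.holder ν hν hL _ (mem (k + 1) hk) _ hx).trans_eq ?_
        rw [add_sub_cancel_left, map_smul_eq_mul, Real.norm_eq_abs, abs_of_pos ht0]
      rw [inner_sub_left, Real.mul_rpow ht0.le hr0] at h2
      have h3 : s ^ (1 + ν) / (1 + ν) + s ^ ν / n ≤ t ^ (1 + ν) / (1 + ν) := by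
        rcases hs0.eq_or_lt with h0 | h0
        · rcases hν.1.eq_or_lt with hz | hz
          · have e : t = 1 / n := by rw [hst, ← h0, zero_add]
            simp [← hz, ← h0, e]
          · rw [← h0, Real.zero_rpow hν0.ne', Real.zero_rpow hz.ne']
            simp only [zero_div, add_zero]
            positivity
        · have hB := one_add_mul_self_le_rpow_one_add (s := 1 / n / s) (p := 1 + ν)
            (by have : 0 < 1 / n / s := by positivity
                linarith) (by linarith [hν.1])
          have e2 : t ^ (1 + ν) = s ^ (1 + ν) * (1 + 1 / n / s) ^ (1 + ν) := by
            rw [← Real.mul_rpow hs0 (by positivity), hst]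
            congr 1
            field_simp
          have e3 : s ^ (1 + ν) = s ^ ν * s := by
            rw [add_comm, Real.rpow_add_one h0.ne']
          have h4 : s ^ (1 + ν) * (1 + (1 + ν) * (1 / n / s)) ≤ t ^ (1 + ν) := by
            rw [e2]; exact mul_le_mul_of_nonneg_left hB (by positivity)
          rw [le_div_iff₀ hν0]
          refine le_trans (le_of_eq ?_) h4
          rw [e3]
          field_simp
      have h5 : (1 / n : ℝ) * (⟪f' (x + t • (y - x)), y - x⟫_ℝ - ⟪f' x, y - x⟫_ℝ)
          ≤ (1 / n : ℝ) * (l * (t ^ ν * r ^ ν) * r) := mul_le_mul_of_nonneg_left h2 hn1.le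
      have h6 : (1 / n : ℝ) * (l * (t ^ ν * r ^ ν) * r) = l * r ^ (1 + ν) * (t ^ ν / n) := by
        rw [← hrr]; ring
      have h7 := mul_le_mul_of_nonneg_left h3 (show 0 ≤ l * r ^ (1 + ν) by positivity)
      rw [mul_add (l * r ^ (1 + ν))]
      have h8 : t * ⟪f' x, y - x⟫_ℝ = s * ⟪f' x, y - x⟫_ℝ + 1 / n * ⟪f' x, y - x⟫_ℝ := by
        rw [hst]; ring
      linarith
  have lim : Filter.Tendsto (fun n : ℕ => l * r ^ (1 + ν) * (1 / (1 + ν) + 1 / ((n : ℝ) + 1)))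
      Filter.atTop (nhds (l * r ^ (1 + ν) * (1 / (1 + ν) + 0))) :=
    (tendsto_one_div_add_atTop_nhds_zero_nat.const_add _).const_mul _
  have hfin := ge_of_tendsto' lim (b := f y - f x - ⟪f' x, y - x⟫_ℝ) (fun n => by
    have hk := key (n + 1) n.succ_pos (n + 1) le_rfl
    have e : (((n + 1 : ℕ) : ℝ)) / ((n + 1 : ℕ) : ℝ) = 1 :=
      div_self (by exact_mod_cast n.succ_ne_zero)
    rw [e] at hk
    simpa using hk)
  refine hfin.trans_eq ?_
  ring

/-! ### Methods -/

/-- A deterministic first-order method on `Q`. Everything it learns about the objective is the list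
of the oracle's answers received so far (earliest first); from this list it determines the next
query point and its current approximate solution, both of them in `Q`. -/
structure Method (Q : Set E) where
  query : List (ℝ × E) → Q
  output : List (ℝ × E) → Q

/-- The answers received in the first `n` iterations, when the oracle is `x ↦ (F x, G x)`. Every
iteration makes exactly one call of the oracle. -/
def Method.answers {Q : Set E} (M : Method Q) (F : E → ℝ) (G : E → E) : ℕ → List (ℝ × E)
  | 0 => []
  | n + 1 => M.answers F G n ++
      [(F (M.query (M.answers F G n)), G (M.query (M.answers F G n)))]

/-- The approximate solution after `n` iterations (`n` oracle calls). -/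
def Method.point {Q : Set E} (M : Method Q) (F : E → ℝ) (G : E → E) (n : ℕ) : E :=
  M.output (M.answers F G n)

/-! ### The iteration counts -/

/-- `max (1, inf_{ν ∈ [0,1]} (L_ν R^(1+ν) / ε)^(2/(1+2pν+ν)))`. -/
def rateConvex (p ε R : ℝ) (L : ℝ → ℝ≥0∞) : ℝ≥0∞ :=
  max 1 (⨅ ν ∈ Set.Icc (0 : ℝ) 1,
    (L ν * ENNReal.ofReal (R ^ (1 + ν)) / ENNReal.ofReal ε) ^ (2 / (1 + 2 * p * ν + ν)))

/-- `max (1, inf_{ν ∈ [0,1]}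
  (L_ν^(2/(1+ν)) / (μ ε^((1-ν)/(1+ν))))^((1+ν)/(1+2pν+ν)) * max (1, ⌈ln (μ R² / ε)⌉))`. -/
def rateStrong (p ε μ R : ℝ) (L : ℝ → ℝ≥0∞) : ℝ≥0∞ :=
  max 1 ((⨅ ν ∈ Set.Icc (0 : ℝ) 1,
    (L ν ^ (2 / (1 + ν)) / ENNReal.ofReal (μ * ε ^ ((1 - ν) / (1 + ν)))) ^
      ((1 + ν) / (1 + 2 * p * ν + ν))) *
    ((max 1 ⌈Real.log (μ * R ^ 2 / ε)⌉₊ : ℕ) : ℝ≥0∞))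

end UniversalMethods

end

/-! The core is an intermediate gradient method with weights `α = (1 + i/2)^p`. If the oracle
satisfies a quadratic upper bound with constant `M` and error `δ'`, a stage of `2T - 1` steps has
accuracy `M (d(u) - m) / T^(1+p) + 2 T^p δ'`. This rests on an estimate sequence (`Estimate.step`),
which needs only `α² ≤ A + α` for the accumulated weight `A`.

A Hölder bound is a quadratic bound with a small extra error, by weighted AM-GM
(`holder_le_quadratic`). With `M = a T^(1+p) / 64` the powers of `T` cancel. The stage then leaves
`a (d(u) - m) / 64 + 3b/128`, provided that `T` is large compared with the rate; `a = ε/R²`, `b = ε`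
in the convex case and `a = μ`, `b = ε` in the strongly convex one.

Since `M` depends only on `a`, `p` and `T`, neither `ν` nor `L_ν` need be known. Schemes with `T =
4096 * 2^k`, `k = 0, 1, ...`, are run in succession and each finally queries its own result. The
lengths grow geometrically, so the first adequate `k` costs a constant times the rate. The query
point with the least answer `F` is at most `δ` worse than that result.

For strongly convex `f`, a scheme consists of several stages, each with the Euclidean prox-function
centred at the previous result. A stage divides the bound on `μ/2 ‖c - u‖²`, with `u` the minimizer,
by 64 up to a multiple of `ε`, so logarithmically many stages suffice. If `Q` is small at scale `ε`,
one stage is enough; otherwise strong convexity forces every term of the infimum to be at least 1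
(`IsHolderProblem.rpow_mul_rpow_le`), so the logarithmic factor is paid for by the rate. -/

noncomputable section

namespace UniversalMethods

variable {E : Type*} [NormedAddCommGroup E] [InnerProductSpace ℝ E]

/-! ### Minimizers of strongly convex functions -/

/-- Strong convexity on `Q` with modulus `m` with respect to a seminorm. -/
def StronglyConvex (nrm : Seminorm ℝ E) (Q : Set E) (m : ℝ) (h : E → ℝ) : Prop :=
  ∀ x ∈ Q, ∀ y ∈ Q, ∀ a b : ℝ, 0 ≤ a → 0 ≤ b → a + b = 1 →
    h (a • x + b • y) ≤ a * h x + b * h y - m * (a * b / 2 * nrm (x - y) ^ 2)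

/-- Lower semicontinuity bounds `h` below near one point `x`. As `Q` is bounded, one `t > 0` moves
every `y` into that neighbourhood along the segment from `x`, and convexity carries the bound back
to `y`. -/
theorem StronglyConvex.bddBelow {nrm : Seminorm ℝ E} {Q : Set E} {m : ℝ} {h : E → ℝ}
    (hm : 0 ≤ m) (hs : StronglyConvex nrm Q m h) (hl : LowerSemicontinuousOn h Q)
    (hQ : Convex ℝ Q) (hb : Bornology.IsBounded Q) : BddBelow (h '' Q) := by
  rcases Q.eq_empty_or_nonempty with rfl | ⟨x, hx⟩
  · simp
  have h1 := hl x hx (h x - 1) (by linarith)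
  rw [eventually_nhdsWithin_iff, Metric.eventually_nhds_iff] at h1
  obtain ⟨r, hr, h1⟩ := h1
  obtain ⟨D, hD0, hD⟩ := hb.exists_pos_norm_le
  set t : ℝ := min 1 (r / (4 * D)) with ht
  have ht0 : 0 < t := by positivity
  have ht1 : t ≤ 1 := min_le_left _ _
  have ht2 : t * (4 * D) ≤ r := by
    rw [← le_div_iff₀ (by positivity)]; exact min_le_right _ _
  refine ⟨h x - 1 / t, ?_⟩
  rintro _ ⟨y, hy, rfl⟩
  have hz := hs x hx y hy (1 - t) t (by linarith) ht0.le (by ring)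
  have hzQ : (1 - t) • x + t • y ∈ Q := hQ hx hy (by linarith) ht0.le (by ring)
  have hd : dist ((1 - t) • x + t • y) x < r := by
    rw [dist_eq_norm, show (1 - t) • x + t • y - x = t • (y - x) by module, norm_smul,
      Real.norm_eq_abs, abs_of_pos ht0]
    have h4 : ‖y - x‖ ≤ 2 * D := (norm_sub_le _ _).trans (by linarith [hD x hx, hD y hy])
    nlinarith
  have h3 := h1 hd hzQ
  have h5 : 0 ≤ m * ((1 - t) * t / 2 * nrm (x - y) ^ 2) := by
    have : 0 ≤ 1 - t := by linarith
    positivity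
  rw [sub_le_iff_le_add, ← sub_le_iff_le_add', le_div_iff₀ ht0]
  linarith

/-- A strongly convex lower semicontinuous function on a bounded closed convex set has a
minimizer, and it grows quadratically around it. -/
theorem StronglyConvex.exists_min [CompleteSpace E] {nrm : Seminorm ℝ E} {Q : Set E} {m : ℝ}
    {h : E → ℝ} (hm : 0 < m) (hs : StronglyConvex nrm Q m h) (hl : LowerSemicontinuousOn h Q)
    (hne : Q.Nonempty) (hcl : IsClosed Q) (hQ : Convex ℝ Q) (hb : Bornology.IsBounded Q)
    {a : ℝ} (ha : 0 < a) (hn : ∀ x, a * ‖x‖ ≤ nrm x) :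
    ∃ z ∈ Q, ∀ x ∈ Q, h z + m / 2 * nrm (x - z) ^ 2 ≤ h x := by
  have hbb := hs.bddBelow hm.le hl hQ hb
  set I := sInf (h '' Q) with hI
  have hIle : ∀ x ∈ Q, I ≤ h x := fun x hx => csInf_le hbb ⟨x, hx, rfl⟩
  have hseq : ∀ n : ℕ, ∃ x ∈ Q, h x < I + 1 / ((n : ℝ) + 1) := fun n => by
    obtain ⟨_, ⟨x, hx, rfl⟩, hlt⟩ := exists_lt_of_csInf_lt (hne.image h)
      (show sInf (h '' Q) < I + 1 / ((n : ℝ) + 1) by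
        have : 0 < 1 / ((n : ℝ) + 1) := by positivity
        linarith)
    exact ⟨x, hx, hlt⟩
  choose x hxQ hxI using hseq
  -- Midpoint strong convexity makes the minimizing sequence Cauchy, so completeness replaces
  -- compactness.
  have hdist : ∀ n k, n ≤ k → m / 8 * (a * dist (x n) (x k)) ^ 2 ≤ 1 / ((n : ℝ) + 1) := by
    intro n k hnk
    have h1 := hs _ (hxQ n) _ (hxQ k) (1 / 2) (1 / 2) (by norm_num) (by norm_num) (by norm_num)
    have h2 := hIle _ (hQ (hxQ n) (hxQ k) (a := 1 / 2) (b := 1 / 2) (by norm_num) (by norm_num)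
      (by norm_num))
    have h3 : 1 / ((k : ℝ) + 1) ≤ 1 / ((n : ℝ) + 1) :=
      one_div_le_one_div_of_le (by positivity) (by exact_mod_cast Nat.succ_le_succ hnk)
    have h4 : (a * dist (x n) (x k)) ^ 2 ≤ nrm (x n - x k) ^ 2 := by
      rw [dist_eq_norm]
      exact pow_le_pow_left₀ (by positivity) (hn _) 2
    have h5 := hxI n
    have h6 := hxI k
    nlinarith
  have hc : CauchySeq x := by
    rw [Metric.cauchySeq_iff']
    intro e he
    obtain ⟨n, hnlt⟩ := exists_nat_one_div_lt (show 0 < m / 8 * (a * e) ^ 2 by positivity)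
    refine ⟨n, fun k hk => ?_⟩
    by_contra! hcon
    have h1 := hdist n k hk
    rw [dist_comm] at hcon
    have h2 : (a * e) ^ 2 ≤ (a * dist (x n) (x k)) ^ 2 := by gcongr
    have h3 : m / 8 * (a * e) ^ 2 ≤ m / 8 * (a * dist (x n) (x k)) ^ 2 := by gcongr
    linarith
  obtain ⟨z, hz⟩ := cauchySeq_tendsto_of_complete hc
  have hzQ : z ∈ Q := hcl.mem_of_tendsto hz (Filter.Eventually.of_forall hxQ)
  have hzI : h z ≤ I := by
    by_contra! hlt
    have h1 := hl z hzQ ((I + h z) / 2) (by linarith)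
    have h2 : Filter.Tendsto x Filter.atTop (nhdsWithin z Q) :=
      tendsto_nhdsWithin_iff.2 ⟨hz, Filter.Eventually.of_forall hxQ⟩
    have h3 := h2.eventually h1
    have h4 : ∀ᶠ n : ℕ in Filter.atTop, 1 / ((n : ℝ) + 1) < (h z - I) / 2 :=
      tendsto_one_div_add_atTop_nhds_zero_nat.eventually_lt_const (by linarith)
    obtain ⟨n, h5, h6⟩ := (h3.and h4).exists
    have := hxI n
    linarith
  refine ⟨z, hzQ, fun y hy => ?_⟩
  refine le_of_forall_pos_le_add fun e he => ?_
  set q := m / 2 * nrm (y - z) ^ 2 with hq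
  have hq0 : 0 ≤ q := by positivity
  -- Quadratic growth: compare `z` with `t y + (1 - t) z`, divide by `t`, and take `t` so small that
  -- `t q ≤ e`.
  set t : ℝ := min 1 (e / (q + 1)) with ht
  have ht0 : 0 < t := by positivity
  have ht1 : t ≤ 1 := min_le_left _ _
  have ht2 : t * (q + 1) ≤ e := by
    rw [← le_div_iff₀ (by positivity)]; exact min_le_right _ _
  have h1 := hs y hy z hzQ t (1 - t) ht0.le (by linarith) (by ring)
  have h2 := hIle _ (hQ hy hzQ ht0.le (by linarith : 0 ≤ 1 - t) (by ring))
  have h3 : t * (h z + (1 - t) * q) ≤ t * h y := by rw [hq]; nlinarith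
  have h4 := le_of_mul_le_mul_left h3 ht0
  nlinarith

/-- The prox-mapping: minimizers of `⟨g, ·⟩ + M d`. -/
theorem IsProxFunction.exists_prox [CompleteSpace E] {nrm : Seminorm ℝ E} {Q : Set E}
    {d : E → ℝ} (hd : IsProxFunction nrm Q d)
    (hne : Q.Nonempty) (hcl : IsClosed Q) (hQ : Convex ℝ Q) (hb : Bornology.IsBounded Q)
    {a : ℝ} (ha : 0 < a) (hn : ∀ x, a * ‖x‖ ≤ nrm x) {M : ℝ} (hM : 0 < M) (g : E) :
    ∃ z : Q, ∀ u ∈ Q, ⟪g, (z : E)⟫_ℝ + M * d z + M / 2 * nrm (u - z) ^ 2 ≤ ⟪g, u⟫_ℝ + M * d u := by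
  have hs : StronglyConvex nrm Q M (fun u => ⟪g, u⟫_ℝ + M * d u) := by
    intro x hx y hy s t hs ht hst
    have h := mul_le_mul_of_nonneg_left (hd.strong x hx y hy s t hs ht hst) hM.le
    simp only [inner_add_right, inner_smul_right]
    linarith
  have hl : LowerSemicontinuousOn (fun u => ⟪g, u⟫_ℝ + M * d u) Q := by
    have hc : Continuous fun u : E => ⟪g, u⟫_ℝ := by fun_prop
    refine LowerSemicontinuousOn.add (hc.lowerSemicontinuous.lowerSemicontinuousOn Q) ?_
    intro x hx c hc
    have h1 := hd.lsc x hx (c / M) ((div_lt_iff₀' hM).2 hc)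
    filter_upwards [h1] with u hu
    exact (div_lt_iff₀' hM).1 hu
  obtain ⟨z, hz, h⟩ := hs.exists_min hM hl hne hcl hQ hb ha hn
  exact ⟨⟨z, hz⟩, h⟩

/-- The centre minimizes `d`. Growth around it bounds `Q` in terms of `R`; in particular `R = 0`
makes `Q` a single point. -/
theorem IsProxFunction.exists_center [CompleteSpace E] {nrm : Seminorm ℝ E} {Q : Set E}
    {d : E → ℝ} (hd : IsProxFunction nrm Q d)
    (hne : Q.Nonempty) (hcl : IsClosed Q) (hQ : Convex ℝ Q) (hb : Bornology.IsBounded Q)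
    {a : ℝ} (ha : 0 < a) (hn : ∀ x, a * ‖x‖ ≤ nrm x) :
    ∃ z ∈ Q, ∀ u ∈ Q, 0 ≤ d u - d z ∧ d u - d z ≤ proxDiam Q d ^ 2 ∧
      nrm (u - z) ^ 2 ≤ 2 * proxDiam Q d ^ 2 := by
  obtain ⟨⟨z, hz⟩, h⟩ := hd.exists_prox hne hcl hQ hb ha hn one_pos 0
  simp only [inner_zero_left, zero_add, one_mul] at h
  have hbb : BddBelow (d '' Q) := by
    refine ⟨d z, ?_⟩
    rintro _ ⟨u, hu, rfl⟩
    have := h u hu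
    have : 0 ≤ nrm (u - z) ^ 2 := by positivity
    linarith
  refine ⟨z, hz, fun u hu => ?_⟩
  have h1 := h u hu
  have h2 : 0 ≤ nrm (u - z) ^ 2 := by positivity
  have h3 : d u ≤ sSup (d '' Q) := le_csSup hd.bddAbove ⟨u, hu, rfl⟩
  have h4 : sInf (d '' Q) ≤ d z := csInf_le hbb ⟨z, hz, rfl⟩
  have h5 : proxDiam Q d ^ 2 = sSup (d '' Q) - sInf (d '' Q) :=
    Real.sq_sqrt (by linarith)
  rw [h5]
  exact ⟨by linarith, by linarith, by linarith⟩

theorem isProxFunction_euclideanProx {Q : Set E} (hb : Bornology.IsBounded Q) (c : E) :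
    IsProxFunction (normSeminorm ℝ E) Q (euclideanProx c) := by
  have hc : Continuous (euclideanProx c) := by unfold euclideanProx; fun_prop
  refine ⟨hc.lowerSemicontinuous.lowerSemicontinuousOn Q, ?_, ?_⟩
  · obtain ⟨D, hD⟩ := hb.exists_norm_le
    refine ⟨(D + ‖c‖) ^ 2 / 2, ?_⟩
    rintro _ ⟨x, hx, rfl⟩
    have h : ‖x - c‖ ≤ D + ‖c‖ := (norm_sub_le _ _).trans (by linarith [hD x hx])
    unfold euclideanProx
    gcongr
  · intro x _ y _ s t _ _ hst
    obtain rfl : t = 1 - s := by linarith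
    have e1 : s • x + (1 - s) • y - c = s • (x - c) + (1 - s) • (y - c) := by module
    have e2 : x - y = (x - c) - (y - c) := by abel
    simp only [euclideanProx, coe_normSeminorm]
    rw [e1, e2]
    generalize x - c = v
    generalize y - c = w
    rw [norm_add_sq_real, norm_sub_sq_real, norm_smul, norm_smul, inner_smul_left,
      inner_smul_right, mul_pow, mul_pow, Real.norm_eq_abs, Real.norm_eq_abs, sq_abs, sq_abs]
    simp only [conj_trivial]
    apply le_of_eq
    ring

/-! ### One step of the intermediate gradient method -/

/-- The weights `(1 + i / 2) ^ p` of the intermediate gradient method. -/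
def weight (p : ℝ) (i : ℕ) : ℝ := (1 + (i : ℝ) / 2) ^ p

def weightSum (p : ℝ) (i : ℕ) : ℝ := ∑ j ∈ Finset.range i, weight p j

theorem weightSum_succ (p : ℝ) (i : ℕ) : weightSum p (i + 1) = weightSum p i + weight p i :=
  Finset.sum_range_succ _ _

theorem one_le_weight {p : ℝ} (hp : 0 ≤ p) (i : ℕ) : 1 ≤ weight p i :=
  Real.one_le_rpow (by have : (0 : ℝ) ≤ i / 2 := by positivity
                       linarith) hp

theorem weightSum_nonneg {p : ℝ} (hp : 0 ≤ p) (i : ℕ) : 0 ≤ weightSum p i :=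
  Finset.sum_nonneg fun j _ => zero_le_one.trans (one_le_weight hp j)

/-- As `p ≤ 1`, factoring out the smallest value of `(1 + j/2)^(p-1)` reduces this to `p = 1`, where
the sum is explicit. -/
theorem rpow_le_weightSum {p : ℝ} (hp : p ≤ 1) (i : ℕ) :
    (1 + (i : ℝ) / 2) ^ (1 + p) ≤ weightSum p (i + 1) := by
  set t : ℝ := 1 + (i : ℝ) / 2 with ht
  have ht0 : 0 < t := by positivity
  have h1 : ∀ j ∈ Finset.range (i + 1), t ^ (p - 1) * (1 + (j : ℝ) / 2) ≤ weight p j := by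
    intro j hj
    have hji : (j : ℝ) ≤ i := by exact_mod_cast Nat.lt_succ_iff.1 (Finset.mem_range.1 hj)
    have hj0 : (0 : ℝ) < 1 + (j : ℝ) / 2 := by positivity
    have h2 : t ^ (p - 1) ≤ (1 + (j : ℝ) / 2) ^ (p - 1) :=
      Real.rpow_le_rpow_of_nonpos hj0 (by rw [ht]; linarith) (by linarith)
    calc t ^ (p - 1) * (1 + (j : ℝ) / 2) ≤ (1 + (j : ℝ) / 2) ^ (p - 1) * (1 + (j : ℝ) / 2) := by
          gcongr
      _ = weight p j := by
          rw [← Real.rpow_add_one hj0.ne', sub_add_cancel, weight]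
  have h2 : ∀ n : ℕ, ∑ j ∈ Finset.range (n + 1), (1 + (j : ℝ) / 2)
      = ((n : ℝ) + 1) * (1 + (n : ℝ) / 4) := by
    intro n
    induction n with
    | zero => simp
    | succ n ih => rw [Finset.sum_range_succ, ih]; push_cast; ring
  calc t ^ (1 + p) = t ^ (p - 1) * t ^ 2 := by
        rw [← Real.rpow_natCast t 2, ← Real.rpow_add ht0]; congr 1; push_cast; ring
    _ ≤ t ^ (p - 1) * ∑ j ∈ Finset.range (i + 1), (1 + (j : ℝ) / 2) := by
        rw [h2, ht]
        have : (0 : ℝ) ≤ i := by positivity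
        gcongr
        nlinarith
    _ = ∑ j ∈ Finset.range (i + 1), t ^ (p - 1) * (1 + (j : ℝ) / 2) := by rw [Finset.mul_sum]
    _ ≤ weightSum p (i + 1) := Finset.sum_le_sum h1

theorem weight_sq_le {p : ℝ} (hp : p ≤ 1) (i : ℕ) :
    weight p i ^ 2 ≤ weightSum p (i + 1) := by
  refine le_trans ?_ (rpow_le_weightSum hp i)
  have h : (1 : ℝ) ≤ 1 + (i : ℝ) / 2 := by
    have : (0 : ℝ) ≤ i / 2 := by positivity
    linarith
  rw [weight, ← Real.rpow_mul_natCast (by linarith)]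
  exact Real.rpow_le_rpow_of_exponent_le h (by push_cast; linarith)

/-- The estimate-sequence invariant: `κ + ⟨g, ·⟩` is a lower model of `A f`, and `y` is good for
the regularized model up to the accumulated error `e`. -/
structure Estimate (Q : Set E) (f D : E → ℝ) (A e : ℝ) (g y : E) (κ : ℝ) : Prop where
  lower : ∀ u ∈ Q, κ + ⟪g, u⟫_ℝ ≤ A * f u
  upper : ∀ u ∈ Q, A * f y ≤ κ + ⟪g, u⟫_ℝ + D u + e

/-- Let `w` be `x` with `z` replaced by `z'`. Then `w - x = (z' - z)/α`, so the quadratic error at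
`w`, weighted by `α²`, is exactly what the growth of the prox problem at `z` supplies. The oracle
error enters with the same factor `α²`. The new average is a convex combination of `y` and `w`
because `α² ≤ A + α`. -/
theorem Estimate.step {nrm : Seminorm ℝ E} {Q : Set E} (hQ : Convex ℝ Q) {f d : E → ℝ}
    {f' : E → E} (hf : ∀ x ∈ Q, ∀ y ∈ Q, f x + ⟪f' x, y - x⟫_ℝ ≤ f y)
    {A e κ M m δ α : ℝ} {g G x y z z' y' : E} {F : ℝ}
    (h : Estimate Q f (fun u => M * (d u - m)) A e g y κ)
    (hα : 1 ≤ α) (hA : α ^ 2 ≤ A + α)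
    (hz : z ∈ Q) (hz' : z' ∈ Q) (hy : y ∈ Q)
    (hx : x = (1 - 1 / α) • y + (1 / α) • z)
    (hy' : y' = (1 - α / (A + α)) • y + (α / (A + α)) • z')
    (hzmin : ∀ u ∈ Q, ⟪g, z⟫_ℝ + M * d z + M / 2 * nrm (u - z) ^ 2 ≤ ⟪g, u⟫_ℝ + M * d u)
    (hzmin' : ∀ u ∈ Q, ⟪g + α • G, z'⟫_ℝ + M * d z' ≤ ⟪g + α • G, u⟫_ℝ + M * d u)
    (hlow : ∀ u ∈ Q, F + ⟪G, u - x⟫_ℝ ≤ f u)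
    (hup : ∀ u ∈ Q, f u ≤ F + ⟪G, u - x⟫_ℝ + M / 2 * nrm (u - x) ^ 2 + δ) :
    Estimate Q f (fun u => M * (d u - m)) (A + α) (e + α ^ 2 * δ) (g + α • G) y'
      (κ + α * (F - ⟪G, x⟫_ℝ)) := by
  have hα0 : 0 < α := by linarith
  have hA0 : 0 < A + α := lt_of_lt_of_le (by positivity) hA
  have hA1 : 0 ≤ A := by nlinarith
  have hα1 : 0 ≤ 1 - 1 / α := by
    rw [sub_nonneg, div_le_one hα0]; exact hα
  refine ⟨fun u hu => ?_, fun u hu => ?_⟩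
  · have h1 := h.lower u hu
    have h2 := mul_le_mul_of_nonneg_left (hlow u hu) hα0.le
    rw [inner_sub_right] at h2
    rw [inner_add_left, inner_smul_left, conj_trivial]
    linarith
  · have hu' := hzmin' u hu
    have h1 := h.upper z hz
    have h2 := hzmin z' hz'
    set w : E := (1 - 1 / α) • y + (1 / α) • z' with hw
    have hwQ : w ∈ Q := hQ hy hz' hα1 (by positivity) (by ring)
    have hy'Q : y' ∈ Q := by
      rw [hy']
      refine hQ hy hz' ?_ (by positivity) (by ring)
      rw [sub_nonneg, div_le_one hA0]; linarith
    have e1 : w - x = (1 / α) • (z' - z) := by rw [hw, hx]; module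
    have e2 : nrm (w - x) ^ 2 = nrm (z' - z) ^ 2 / α ^ 2 := by
      rw [e1, map_smul_eq_mul, Real.norm_eq_abs, abs_of_pos (by positivity)]
      field_simp
    have h3 := mul_le_mul_of_nonneg_left (hup w hwQ) (sq_nonneg α)
    have h4 := mul_le_mul_of_nonneg_left (hlow y hy) (show 0 ≤ α ^ 2 - α by nlinarith)
    have e3 : α ^ 2 * ⟪G, w - x⟫_ℝ = (α ^ 2 - α) * ⟪G, y - x⟫_ℝ + α * ⟪G, z' - x⟫_ℝ := by
      have : w - x = (1 - 1 / α) • (y - x) + (1 / α) • (z' - x) := by rw [hw]; module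
      rw [this, inner_add_right, inner_smul_right, inner_smul_right]
      field_simp
    have e4 : α ^ 2 * (M / 2 * nrm (w - x) ^ 2) = M / 2 * nrm (z' - z) ^ 2 := by
      rw [e2]; field_simp
    -- convexity of `f` along `y' = (1 - α² / A') y + (α² / A') w`
    have h5 := mul_le_mul_of_nonneg_left (hf y' hy'Q y hy) (show 0 ≤ A + α - α ^ 2 by linarith)
    have h6 := mul_le_mul_of_nonneg_left (hf y' hy'Q w hwQ) (sq_nonneg α)
    -- The subgradient terms at `y'` cancel, since `y'` is the barycentre of `y` and `w` with these
    -- weights.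
    have e5 : (A + α - α ^ 2) * ⟪f' y', y - y'⟫_ℝ + α ^ 2 * ⟪f' y', w - y'⟫_ℝ = 0 := by
      have : (A + α - α ^ 2) • (y - y') + (α ^ 2) • (w - y') = 0 := by
        rw [hy', hw]
        match_scalars <;> field_simp <;> ring
      have h7 := congrArg (fun v => ⟪f' y', v⟫_ℝ) this
      simpa [inner_add_right, inner_smul_right] using h7
    rw [inner_sub_right G z' x] at e3
    simp only [inner_add_left, inner_smul_left, conj_trivial] at hu' ⊢
    nlinarith

/-! ### Methods that output their best query point -/

/-- A minimizer of `v` among the indices below `n`. -/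
def argminBelow (v : ℕ → ℝ) (n : ℕ) : ℕ :=
  open Classical in if h : ∃ i < n, ∀ j < n, v i ≤ v j then h.choose else 0

theorem argminBelow_spec (v : ℕ → ℝ) {n : ℕ} (hn : 0 < n) :
    argminBelow v n < n ∧ ∀ j < n, v (argminBelow v n) ≤ v j := by
  have h : ∃ i < n, ∀ j < n, v i ≤ v j := by
    obtain ⟨i, hi, h⟩ := (Finset.range n).exists_min_image v ⟨0, Finset.mem_range.2 hn⟩
    exact ⟨i, Finset.mem_range.1 hi, fun j hj => h j (Finset.mem_range.2 hj)⟩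
  rw [argminBelow, dif_pos h]
  exact h.choose_spec

/-- The method with query rule `q` that returns the query point with the smallest answer. -/
def bestMethod {Q : Set E} (q : List (ℝ × E) → Q) : Method Q where
  query := q
  -- Answers do not contain the query points; the `i`-th one is recovered from the first `i`
  -- answers.
  output l := q (l.take (argminBelow (fun i => (l.getD i 0).1) l.length))

theorem Method.length_answers {V : Type*} {Q : Set V} (M : Method Q) (F : V → ℝ) (G : V → V)
    (n : ℕ) :
    (M.answers F G n).length = n := by
  induction n with
  | zero => rfl
  | succ n ih => simp [Method.answers, ih]

theorem Method.take_answers {V : Type*} {Q : Set V} (M : Method Q) (F : V → ℝ) (G : V → V)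
    {i n : ℕ} (h : i ≤ n) : (M.answers F G n).take i = M.answers F G i := by
  induction n, h using Nat.le_induction with
  | base => exact List.take_of_length_le (M.length_answers F G i).le
  | succ n h ih =>
    rw [Method.answers, List.take_append_of_le_length (by rwa [M.length_answers]), ih]

theorem Method.getD_answers {V : Type*} [NormedAddCommGroup V] {Q : Set V} (M : Method Q)
    (F : V → ℝ) (G : V → V) {i n : ℕ} (h : i < n) : (M.answers F G n).getD i 0 =
      (F (M.query (M.answers F G i)), G (M.query (M.answers F G i))) := by
  have h1 := M.take_answers F G (Nat.succ_le_of_lt h)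
  have h2 : (M.answers F G n).getD i 0 = ((M.answers F G n).take (i + 1)).getD i 0 := by
    simp [List.getD_eq_getElem?_getD]
  rw [h2, h1, Method.answers, List.getD_append_right _ _ _ _ (M.length_answers F G i).le]
  simp [M.length_answers]

theorem bestMethod_point_le {V : Type*} [NormedAddCommGroup V] {Q : Set V}
    (q : List (ℝ × V) → Q) {f F : V → ℝ} (G : V → V) {δ : ℝ}
    (h1 : ∀ x ∈ Q, F x ≤ f x) (h2 : ∀ x ∈ Q, f x ≤ F x + δ) {i n : ℕ} (hi : i < n) :
    f ((bestMethod q).point F G n) ≤ f (q ((bestMethod q).answers F G i)) + δ := by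
  set v : ℕ → ℝ := fun i => (((bestMethod q).answers F G n).getD i 0).1 with hv
  have hvj : ∀ j < n, v j = F (q ((bestMethod q).answers F G j)) := fun j hj => by
    rw [hv]; simp only [Method.getD_answers _ F G hj]; rfl
  obtain ⟨h3, h4⟩ := argminBelow_spec v (by omega : 0 < n)
  have e : (bestMethod q).point F G n = q ((bestMethod q).answers F G (argminBelow v n)) := by
    change ((q _ : Q) : V) = _
    rw [Method.length_answers, Method.take_answers _ F G h3.le]
  have h5 := h4 i hi
  rw [hvj _ h3, hvj _ hi] at h5
  rw [e]
  linarith [h2 _ (q ((bestMethod q).answers F G (argminBelow v n))).2,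
    h1 _ (q ((bestMethod q).answers F G i)).2]

/-! ### Running methods one after the other -/

def phaseStart (b : ℕ → ℕ) (k : ℕ) : ℕ := ∑ j ∈ Finset.range k, b j

theorem phaseStart_succ (b : ℕ → ℕ) (k : ℕ) : phaseStart b (k + 1) = phaseStart b k + b k :=
  Finset.sum_range_succ _ _

/-- The phase to which iteration `n` belongs, if phase `k` consists of `b k` iterations. -/
def phase (b : ℕ → ℕ) (n : ℕ) : ℕ := Nat.findGreatest (fun k => phaseStart b k ≤ n) n

theorem phase_eq {b : ℕ → ℕ} (hb : ∀ k, 0 < b k) {k i : ℕ} (hi : i < b k) :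
    phase b (phaseStart b k + i) = k := by
  have hm : StrictMono (phaseStart b) :=
    strictMono_nat_of_lt_succ fun k => by rw [phaseStart_succ]; exact Nat.lt_add_of_pos_right (hb k)
  rw [phase, Nat.findGreatest_eq_iff]
  refine ⟨(hm.id_le k).trans (Nat.le_add_right _ _), fun _ => Nat.le_add_right _ _,
    fun j hj _ => ?_⟩
  have h := hm.monotone (Nat.succ_le_of_lt hj)
  rw [Nat.succ_eq_add_one, phaseStart_succ] at h
  omega

/-- Follow the query rule `q k` during phase `k`, forgetting the earlier phases. -/
def phasedQuery {Q : Set E} (q : ℕ → List (ℝ × E) → Q) (b : ℕ → ℕ) (l : List (ℝ × E)) : Q :=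
  q (phase b l.length) (l.drop (phaseStart b (phase b l.length)))

/-- Within phase `k` the combined method sees what `q k` would see when run alone, so each phase can
be analysed in isolation. -/
theorem drop_answers_phasedQuery {V : Type*} [NormedAddCommGroup V] {Q : Set V}
    (q : ℕ → List (ℝ × V) → Q) {b : ℕ → ℕ} (hb : ∀ k, 0 < b k)
    (F : V → ℝ) (G : V → V) (k : ℕ) {i : ℕ} (hi : i ≤ b k) :
    ((bestMethod (phasedQuery q b)).answers F G (phaseStart b k + i)).drop (phaseStart b k) =
      (bestMethod (q k)).answers F G i := by
  induction i with
  | zero => simp [Method.answers, Method.length_answers]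
  | succ i ih =>
    have ih := ih (by omega)
    have e : (bestMethod (phasedQuery q b)).query
        ((bestMethod (phasedQuery q b)).answers F G (phaseStart b k + i)) =
        (bestMethod (q k)).query ((bestMethod (q k)).answers F G i) := by
      change phasedQuery q b _ = q k _
      rw [phasedQuery, Method.length_answers, phase_eq hb (by omega), ih]
    rw [← add_assoc, Method.answers, List.drop_append_of_le_length
      (by rw [Method.length_answers]; omega), ih, e]
    rfl

theorem phasedQuery_answers {V : Type*} [NormedAddCommGroup V] {Q : Set V}
    (q : ℕ → List (ℝ × V) → Q) {b : ℕ → ℕ} (hb : ∀ k, 0 < b k)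
    (F : V → ℝ) (G : V → V) (k : ℕ) {i : ℕ} (hi : i < b k) :
    phasedQuery q b ((bestMethod (phasedQuery q b)).answers F G (phaseStart b k + i)) =
      q k ((bestMethod (q k)).answers F G i) := by
  rw [phasedQuery, Method.length_answers, phase_eq hb hi, drop_answers_phasedQuery q hb F G k hi.le]

/-! ### The restarted intermediate gradient method -/

/-- The point `(1 - t) x + t y`. -/
def mix {Q : Set E} (x y : Q) (t : ℝ) : Q :=
  open Classical in if h : (1 - t) • (x : E) + t • (y : E) ∈ Q then ⟨_, h⟩ else x

theorem coe_mix {Q : Set E} (hQ : Convex ℝ Q) (x y : Q) {t : ℝ} (h0 : 0 ≤ t) (h1 : t ≤ 1) :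
    (mix x y t : E) = (1 - t) • (x : E) + t • (y : E) := by
  rw [mix, dif_pos (hQ x.2 y.2 (by linarith) h0 (by ring))]

/-- The state of the method: the number of steps since the last restart, the prox-centre, the
weighted sum of the gradients received since the last restart, and the averaged point. -/
structure State (Q : Set E) where
  idx : ℕ
  center : Q
  grad : E
  avg : Q

def State.fresh {Q : Set E} (c : Q) : State Q := ⟨0, c, 0, c⟩

/-- The data of a restarted intermediate gradient method: the prox-mapping for each centre, the
exponent of the weights, the number of steps in each stage, the number of stages and the starting
point. -/
structure Scheme (Q : Set E) where
  prox : Q → E → Q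
  p : ℝ
  steps : ℕ
  stages : ℕ
  start : Q

namespace Scheme

variable {Q : Set E} (P : Scheme Q)

/-- The query uses the mixing weight `1/α`, the average uses `α/A'` with `A'` the new weight sum.
They coincide only when `α² = A'`. -/
def query (s : State Q) : Q := mix s.avg (P.prox s.center s.grad) (1 / weight P.p s.idx)

def advance (s : State Q) (G : E) : State Q where
  idx := s.idx + 1
  center := s.center
  grad := s.grad + weight P.p s.idx • G
  avg := mix s.avg (P.prox s.center (s.grad + weight P.p s.idx • G))
    (weight P.p s.idx / weightSum P.p (s.idx + 1))

def update (s : State Q) (G : E) : State Q :=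
  if s.idx + 1 = P.steps then State.fresh (P.advance s G).avg else P.advance s G

def state (l : List (ℝ × E)) : State Q :=
  l.foldl (fun s a => P.update s a.2) (State.fresh P.start)

/-- The second branch spends one extra call on the result itself, so that it competes among the
query points. -/
def next (l : List (ℝ × E)) : Q :=
  if l.length < P.stages * P.steps then P.query (P.state l) else (P.state l).avg

/-- The states of one stage with prox-centre `c`. -/
def stage (G : E → E) (c : Q) : ℕ → State Q
  | 0 => State.fresh c
  | i + 1 => P.advance (stage G c i) (G (P.query (stage G c i)))

/-- The result of `j` stages. -/
def result (G : E → E) : ℕ → Q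
  | 0 => P.start
  | j + 1 => (P.stage G (result G j) P.steps).avg

theorem idx_stage (G : E → E) (c : Q) (i : ℕ) : (P.stage G c i).idx = i := by
  induction i with
  | zero => rfl
  | succ i ih => simp [stage, advance, ih]

theorem center_stage (G : E → E) (c : Q) (i : ℕ) : (P.stage G c i).center = c := by
  induction i with
  | zero => rfl
  | succ i ih => simp [stage, advance, ih]

theorem state_answers_succ (F : E → ℝ) (G : E → E) {n : ℕ} (hn : n < P.stages * P.steps) :
    P.state ((bestMethod P.next).answers F G (n + 1)) =
      P.update (P.state ((bestMethod P.next).answers F G n))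
        (G (P.query (P.state ((bestMethod P.next).answers F G n)))) := by
  have e : (bestMethod P.next).query ((bestMethod P.next).answers F G n) =
      P.query (P.state ((bestMethod P.next).answers F G n)) := by
    change P.next _ = _
    rw [next, Method.length_answers, if_pos hn]
  rw [Method.answers, e]
  simp [state, List.foldl_append]

theorem state_answers_stage (F : E → ℝ) (G : E → E) (j : ℕ) (hj : j < P.stages)
    (h : P.state ((bestMethod P.next).answers F G (j * P.steps)) = State.fresh (P.result G j))
    {i : ℕ} (hi : i < P.steps) :
    P.state ((bestMethod P.next).answers F G (j * P.steps + i)) =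
      P.stage G (P.result G j) i := by
  have hle : (j + 1) * P.steps ≤ P.stages * P.steps := Nat.mul_le_mul_right _ hj
  rw [Nat.succ_mul] at hle
  induction i with
  | zero => simpa [stage] using h
  | succ i ih =>
    rw [← add_assoc, P.state_answers_succ F G (by omega), ih (by omega), update, idx_stage,
      if_neg (by omega), stage]

theorem state_answers_restart (F : E → ℝ) (G : E → E) (hN : 0 < P.steps) {j : ℕ}
    (hj : j ≤ P.stages) :
    P.state ((bestMethod P.next).answers F G (j * P.steps)) = State.fresh (P.result G j) := by
  induction j with
  | zero => simp [Method.answers, state, result]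
  | succ j ih =>
    have h1 := P.state_answers_stage F G j (by omega) (ih (by omega))
      (i := P.steps - 1) (by omega)
    have hle : (j + 1) * P.steps ≤ P.stages * P.steps := Nat.mul_le_mul_right _ hj
    have e : (j + 1) * P.steps = j * P.steps + (P.steps - 1) + 1 := by
      rw [Nat.succ_mul]; omega
    rw [e] at hle ⊢
    rw [P.state_answers_succ F G (by omega), h1, update, idx_stage, if_pos (by omega), result]
    congr 2
    conv_rhs => rw [show P.steps = P.steps - 1 + 1 by omega, stage]

/-- After its last stage the method queries the result. -/
theorem next_answers (F : E → ℝ) (G : E → E) (hN : 0 < P.steps) :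
    P.next ((bestMethod P.next).answers F G (P.stages * P.steps)) = P.result G P.stages := by
  rw [next, Method.length_answers, if_neg (lt_irrefl _), P.state_answers_restart F G hN le_rfl]
  rfl

/-- The prox-mapping of `P` solves the auxiliary problems for the prox-functions `d c` with
parameter `M`. -/
def IsProx (nrm : Seminorm ℝ E) (d : Q → E → ℝ) (M : ℝ) : Prop :=
  ∀ c g, ∀ u ∈ Q, ⟪g, (P.prox c g : E)⟫_ℝ + M * d c (P.prox c g) +
    M / 2 * nrm (u - P.prox c g) ^ 2 ≤ ⟪g, u⟫_ℝ + M * d c u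

theorem exists_estimate {nrm : Seminorm ℝ E} (hQ : Convex ℝ Q) {d : Q → E → ℝ} {M m δ : ℝ}
    (hp0 : 0 ≤ P.p) (hp1 : P.p ≤ 1) (hM : 0 ≤ M) (hP : P.IsProx nrm d M)
    {f F : E → ℝ} {f' G : E → E}
    (hf : ∀ x ∈ Q, ∀ y ∈ Q, f x + ⟪f' x, y - x⟫_ℝ ≤ f y)
    (hlow : ∀ x ∈ Q, ∀ u ∈ Q, F x + ⟪G x, u - x⟫_ℝ ≤ f u)
    (hup : ∀ x ∈ Q, ∀ u ∈ Q, f u ≤ F x + ⟪G x, u - x⟫_ℝ + M / 2 * nrm (u - x) ^ 2 + δ)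
    {c : Q} (hm : ∀ u ∈ Q, m ≤ d c u) (i : ℕ) :
    ∃ κ, Estimate Q f (fun u => M * (d c u - m)) (weightSum P.p i)
      (∑ j ∈ Finset.range i, weight P.p j ^ 2 * δ)
      (P.stage G c i).grad (P.stage G c i).avg κ := by
  induction i with
  | zero =>
    refine ⟨0, ⟨fun u hu => ?_, fun u hu => ?_⟩⟩
    · simp [stage, State.fresh, weightSum]
    · have := mul_nonneg hM (sub_nonneg.2 (hm u hu))
      simpa [stage, State.fresh, weightSum] using this
  | succ i ih =>
    obtain ⟨κ, h⟩ := ih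
    set s := P.stage G c i with hs
    have hidx : s.idx = i := P.idx_stage G c i
    have hc : s.center = c := P.center_stage G c i
    have hα := one_le_weight hp0 i
    have hA := weight_sq_le hp1 i
    have hS := weightSum_nonneg hp0 i
    rw [weightSum_succ] at hA
    have hx : (P.query s : E) =
        (1 - 1 / weight P.p i) • (s.avg : E) + (1 / weight P.p i) • (P.prox c s.grad : E) := by
      rw [query, hidx, hc, coe_mix hQ _ _ (by positivity)]
      rw [div_le_one (by linarith)]; exact hα
    have hy : ((P.stage G c (i + 1)).avg : E) =
        (1 - weight P.p i / (weightSum P.p i + weight P.p i)) • (s.avg : E) +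
          (weight P.p i / (weightSum P.p i + weight P.p i)) •
            (P.prox c (s.grad + weight P.p i • G (P.query s)) : E) := by
      rw [stage, ← hs, advance]
      simp only [hidx, hc]
      rw [weightSum_succ, coe_mix hQ _ _ (by positivity)]
      rw [div_le_one (by linarith)]; linarith
    have hg : (P.stage G c (i + 1)).grad = s.grad + weight P.p i • G (P.query s) := by
      rw [stage, ← hs, advance]
      simp only [hidx]
    rw [weightSum_succ, Finset.sum_range_succ, hg]
    refine ⟨_, h.step hQ hf hα hA (P.prox c s.grad).2
      (P.prox c (s.grad + weight P.p i • G (P.query s))).2 s.avg.2 hx hy (hP c _) ?_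
      (hlow _ (P.query s).2) (hup _ (P.query s).2)⟩
    intro u hu
    have h1 := hP c (s.grad + weight P.p i • G (P.query s)) u hu
    have : 0 ≤ M / 2 * nrm (u - P.prox c (s.grad + weight P.p i • G (P.query s))) ^ 2 := by
      positivity
    linarith

/-- The accuracy of one stage. -/
theorem stage_sub_le {nrm : Seminorm ℝ E} (hQ : Convex ℝ Q) {d : Q → E → ℝ} {M m δ : ℝ}
    (hp0 : 0 ≤ P.p) (hp1 : P.p ≤ 1) (hM : 0 ≤ M) (hδ : 0 ≤ δ) (hP : P.IsProx nrm d M)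
    {f F : E → ℝ} {f' G : E → E}
    (hf : ∀ x ∈ Q, ∀ y ∈ Q, f x + ⟪f' x, y - x⟫_ℝ ≤ f y)
    (hlow : ∀ x ∈ Q, ∀ u ∈ Q, F x + ⟪G x, u - x⟫_ℝ ≤ f u)
    (hup : ∀ x ∈ Q, ∀ u ∈ Q, f u ≤ F x + ⟪G x, u - x⟫_ℝ + M / 2 * nrm (u - x) ^ 2 + δ)
    {c : Q} (hm : ∀ u ∈ Q, m ≤ d c u) {T : ℕ} (hT : 0 < T) (hN : P.steps + 1 = 2 * T)
    {u : E} (hu : u ∈ Q) :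
    f (P.stage G c P.steps).avg - f u ≤ M * (d c u - m) / (T : ℝ) ^ (1 + P.p)
      + 2 * (T : ℝ) ^ P.p * δ := by
  obtain ⟨κ, h⟩ := P.exists_estimate hQ hp0 hp1 hM hP hf hlow hup hm P.steps
  have hT0 : (0 : ℝ) < T := by exact_mod_cast hT
  have hNR : (P.steps : ℝ) + 1 = 2 * T := by exact_mod_cast hN
  -- The last index is `2T - 2`, and `1 + (2T - 2)/2 = T`.
  have hA : (T : ℝ) ^ (1 + P.p) ≤ weightSum P.p P.steps := by
    obtain ⟨i, hi⟩ : ∃ i, P.steps = i + 1 := ⟨P.steps - 1, by omega⟩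
    have := rpow_le_weightSum hp1 i
    rw [hi] at hNR ⊢
    rwa [show (1 : ℝ) + i / 2 = T by push_cast at hNR; linarith] at this
  -- Fewer than `2T` steps, each with squared weight at most `T^(2p)`.
  have hE : ∑ j ∈ Finset.range P.steps, weight P.p j ^ 2 * δ
      ≤ (T : ℝ) ^ (1 + P.p) * (2 * (T : ℝ) ^ P.p * δ) := by
    have h1 : ∀ j ∈ Finset.range P.steps, weight P.p j ^ 2 * δ ≤ ((T : ℝ) ^ P.p) ^ 2 * δ := by
      intro j hj
      have hj' : (j : ℝ) + 1 ≤ P.steps := by exact_mod_cast Finset.mem_range.1 hj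
      have h2 : weight P.p j ≤ (T : ℝ) ^ P.p :=
        Real.rpow_le_rpow (by positivity) (by linarith) hp0
      have h3 := one_le_weight hp0 j
      gcongr
    refine (Finset.sum_le_sum h1).trans ?_
    rw [Finset.sum_const, Finset.card_range, nsmul_eq_mul, Real.rpow_add hT0, Real.rpow_one]
    have h2 : (P.steps : ℝ) ≤ 2 * T := by linarith
    calc (P.steps : ℝ) * (((T : ℝ) ^ P.p) ^ 2 * δ) ≤ 2 * T * (((T : ℝ) ^ P.p) ^ 2 * δ) := by
          gcongr
      _ = _ := by ring
  have h1 := h.upper u hu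
  have h2 := h.lower u hu
  have hTp : 0 < (T : ℝ) ^ (1 + P.p) := by positivity
  have hd : 0 ≤ M * (d c u - m) := mul_nonneg hM (sub_nonneg.2 (hm u hu))
  have hr : 0 ≤ M * (d c u - m) / (T : ℝ) ^ (1 + P.p) + 2 * (T : ℝ) ^ P.p * δ := by positivity
  have h3 : weightSum P.p P.steps * (f (P.stage G c P.steps).avg - f u) ≤
      (T : ℝ) ^ (1 + P.p) * (M * (d c u - m) / (T : ℝ) ^ (1 + P.p) + 2 * (T : ℝ) ^ P.p * δ) := by
    rw [mul_add, mul_div_cancel₀ _ hTp.ne']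
    linarith
  have h4 := h3.trans (mul_le_mul_of_nonneg_right hA hr)
  exact le_of_mul_le_mul_left h4 (hTp.trans_le hA)

end Scheme

/-! ### Smoothing the Hölder bound -/

/-- Weighted AM-GM for `a T^(1+p) r²` and `b T^(-p)` with weights `(1 ± ν)/2`, where `T = 4096 G`.
The exponents of `T` add up to `(1 + 2pν + ν)/2`, which is the source of the exponent in the rates.
That exponent is at least `1/2`, so passing from `G` to `T` gains the factor `64 = √4096`. -/
theorem holder_le_quadratic {a b l r G p ν : ℝ} (ha : 0 ≤ a) (hb : 0 ≤ b) (hr : 0 ≤ r)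
    (hG : 0 < G) (hp : 0 ≤ p) (hν : ν ∈ Set.Icc (0 : ℝ) 1)
    (hl : l ≤ a ^ ((1 + ν) / 2) * b ^ ((1 - ν) / 2) * G ^ ((1 + 2 * p * ν + ν) / 2)) :
    l / (1 + ν) * r ^ (1 + ν) ≤ a * (4096 * G) ^ (1 + p) / 64 / 2 * r ^ 2 +
      b * (4096 * G) ^ (-p) / 128 := by
  obtain ⟨h0, h1⟩ := hν
  set T := 4096 * G with hT
  have hT0 : 0 < T := by positivity
  have hpν : 0 ≤ p * ν := by positivity
  have hν0 : 0 < 1 + ν := by linarith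
  set u := a * T ^ (1 + p) * r ^ 2 with hu
  set v := b * T ^ (-p) with hv
  have hu0 : 0 ≤ u := by positivity
  have hv0 : 0 ≤ v := by positivity
  have hG' : G ^ ((1 + 2 * p * ν + ν) / 2) * 64 ≤ T ^ ((1 + 2 * p * ν + ν) / 2) := by
    rw [hT, Real.mul_rpow (by norm_num) hG.le, mul_comm]
    refine mul_le_mul_of_nonneg_right ?_ (by positivity)
    calc (64 : ℝ) = 4096 ^ (1 / 2 : ℝ) := by
          rw [← Real.sqrt_eq_rpow, show (4096 : ℝ) = 64 ^ 2 by norm_num,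
            Real.sqrt_sq (by norm_num)]
      _ ≤ _ := Real.rpow_le_rpow_of_exponent_le (by norm_num) (by linarith)
  clear_value T
  have hprod : a ^ ((1 + ν) / 2) * b ^ ((1 - ν) / 2) * T ^ ((1 + 2 * p * ν + ν) / 2) * r ^ (1 + ν)
      = u ^ ((1 + ν) / 2) * v ^ ((1 - ν) / 2) := by
    rw [hu, hv, Real.mul_rpow (by positivity) (by positivity), Real.mul_rpow ha (by positivity),
      Real.mul_rpow hb (by positivity), ← Real.rpow_mul hT0.le, ← Real.rpow_mul hT0.le,
      ← Real.rpow_natCast_mul hr, show (1 + 2 * p * ν + ν) / 2 =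
        (1 + p) * ((1 + ν) / 2) + -p * ((1 - ν) / 2) by ring, Real.rpow_add hT0,
      show ((2 : ℕ) : ℝ) * ((1 + ν) / 2) = 1 + ν by push_cast; ring]
    ring
  have hamgm := Real.geom_mean_le_arith_mean2_weighted (w₁ := (1 + ν) / 2) (w₂ := (1 - ν) / 2)
    (by linarith) (by linarith) hu0 hv0 (by ring)
  have h2 : l * r ^ (1 + ν) * 64 ≤ (1 + ν) / 2 * u + (1 - ν) / 2 * v := by
    refine le_trans ?_ (hprod.le.trans hamgm)
    calc l * r ^ (1 + ν) * 64 ≤ a ^ ((1 + ν) / 2) * b ^ ((1 - ν) / 2) *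
          G ^ ((1 + 2 * p * ν + ν) / 2) * r ^ (1 + ν) * 64 := by gcongr
      _ = a ^ ((1 + ν) / 2) * b ^ ((1 - ν) / 2) *
          (G ^ ((1 + 2 * p * ν + ν) / 2) * 64) * r ^ (1 + ν) := by ring
      _ ≤ _ := by gcongr
  rw [div_mul_eq_mul_div, div_le_iff₀ hν0]
  have h3 : 0 ≤ ν * v := by positivity
  have e : a * T ^ (1 + p) / 64 / 2 * r ^ 2 = u / 128 := by rw [hu]; ring
  rw [e]
  linarith

/-! ### Accuracy of a stage, with an inexact oracle of a Hölder problem -/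

namespace Scheme

variable {Q : Set E}

theorem exists_isProx [CompleteSpace E] {nrm : Seminorm ℝ E} {d : Q → E → ℝ}
    (hd : ∀ c, IsProxFunction nrm Q (d c))
    (hne : Q.Nonempty) (hcl : IsClosed Q) (hQ : Convex ℝ Q) (hb : Bornology.IsBounded Q)
    {a : ℝ} (ha : 0 < a) (hn : ∀ x, a * ‖x‖ ≤ nrm x) {M : ℝ} (hM : 0 < M) (p : ℝ) (N S : ℕ) :
    ∃ P : Scheme Q, P.IsProx nrm d M ∧ P.p = p ∧ P.steps = N ∧ P.stages = S := by
  choose prox hprox using fun c g => (hd c).exists_prox hne hcl hQ hb ha hn hM g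
  obtain ⟨x, hx⟩ := hne
  exact ⟨⟨prox, p, N, S, ⟨x, hx⟩⟩, hprox, rfl, rfl, rfl⟩

/-- The factor `T^(1+p)` in `M` cancels the gain of the stage, and the smoothing error `b
T^(-p)/128` cancels the accumulation `2 T^p`, leaving `b/64`; the oracle error adds at most `b/128`.
-/
theorem stage_sub_le_of_oracle (P : Scheme Q) {nrm : Seminorm ℝ E} (hQ : Convex ℝ Q)
    {d : Q → E → ℝ} {m μ δ a b : ℝ} {k : ℕ} (hμ : 0 ≤ μ) (ha : 0 ≤ a) (hb : 0 ≤ b)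
    (hp : P.p ∈ Set.Icc (0 : ℝ) 1)
    (hN : P.steps = 8192 * 2 ^ k - 1) (hδ : 0 ≤ δ)
    (hP : P.IsProx nrm d (a * (4096 * 2 ^ k : ℝ) ^ (1 + P.p) / 64))
    {L : ℝ → ℝ≥0∞} {f F : E → ℝ} {f' G : E → E}
    (hf : ∀ x ∈ Q, ∀ y ∈ Q, f x + ⟪f' x, y - x⟫_ℝ ≤ f y)
    (ho : IsInexactOracle nrm Q μ δ L f F G)
    {ν : ℝ} (hν : ν ∈ Set.Icc (0 : ℝ) 1) (hLt : L ν ≠ ∞)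
    (hL : (L ν).toReal ≤ a ^ ((1 + ν) / 2) * b ^ ((1 - ν) / 2) *
      ((2 : ℝ) ^ k) ^ ((1 + 2 * P.p * ν + ν) / 2))
    (hδb : (4096 * 2 ^ k : ℝ) ^ P.p * δ ≤ b / 256)
    {c : Q} (hm : ∀ u ∈ Q, m ≤ d c u) {u : E} (hu : u ∈ Q) :
    f (P.stage G c P.steps).avg - f u ≤ a * (d c u - m) / 64 + 3 * b / 128 := by
  set T : ℝ := 4096 * 2 ^ k with hT
  have hT0 : 0 < T := by positivity
  have h2k : 0 < 2 ^ k := by positivity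
  have h := P.stage_sub_le hQ (δ := δ + b * T ^ (-P.p) / 128) hp.1 hp.2 (by positivity)
    (by positivity) hP hf (F := F) (G := G)
    (fun x hx u hu => by
      have h1 := ho.lower x hx u hu
      have : 0 ≤ μ / 2 * nrm (u - x) ^ 2 := by positivity
      linarith)
    (fun x hx u hu => by
      have h1 := ho.upper ν hν hLt x hx u hu
      have h2 := holder_le_quadratic ha hb (apply_nonneg nrm (u - x))
        (show (0 : ℝ) < 2 ^ k by positivity) hp.1 hν hL
      rw [← hT] at h2
      linarith)
    hm (T := 4096 * 2 ^ k) (by positivity) (by omega) hu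
  push_cast at h
  rw [← hT] at h
  refine h.trans ?_
  have e1 : a * T ^ (1 + P.p) / 64 * (d c u - m) / T ^ (1 + P.p) = a * (d c u - m) / 64 := by
    have : T ^ (1 + P.p) ≠ 0 := (Real.rpow_pos_of_pos hT0 _).ne'
    field_simp
  have e2 : T ^ P.p * T ^ (-P.p) = 1 := by
    rw [← Real.rpow_add hT0, add_neg_cancel, Real.rpow_zero]
  have e3 : 2 * T ^ P.p * (δ + b * T ^ (-P.p) / 128) =
      2 * (T ^ P.p * δ) + b / 64 * (T ^ P.p * T ^ (-P.p)) := by ring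
  rw [e1, e3, e2]
  linarith

/-- The number of iterations of the `k`-th phase. -/
def budget (S k : ℕ) : ℕ := S * (8192 * 2 ^ k - 1) + 1

/-- The universal method: run the schemes `P 0`, `P 1`, … one after the other. -/
def universal (P : ℕ → Scheme Q) (S : ℕ) : Method Q :=
  bestMethod (phasedQuery (fun k => (P k).next) (budget S))

/-- Geometric sum; the `- 1` in each stage pays for the extra query of the phase, as `S ≥ 1`. -/
theorem phaseStart_budget_le {S : ℕ} (hS : 0 < S) (k : ℕ) :
    phaseStart (budget S) k ≤ S * (8192 * 2 ^ k) := by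
  induction k with
  | zero => simp [phaseStart]
  | succ k ih =>
    have h2k : 0 < 2 ^ k := by positivity
    obtain ⟨j, hj⟩ : ∃ j, 8192 * 2 ^ k = j + 1 := ⟨8192 * 2 ^ k - 1, by omega⟩
    rw [phaseStart_succ, pow_succ, ← mul_assoc, budget]
    rw [hj] at ih ⊢
    rw [Nat.add_sub_cancel]
    nlinarith

theorem universal_sub_le {P : ℕ → Scheme Q} {S : ℕ} (hS : 0 < S) (hPS : ∀ k, (P k).stages = S)
    (hPN : ∀ k, (P k).steps = 8192 * 2 ^ k - 1) {μ δ ε r : ℝ}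
    {nrm : Seminorm ℝ E} {L : ℝ → ℝ≥0∞} {f F : E → ℝ} {G : E → E}
    (ho : IsInexactOracle nrm Q μ δ L f F G)
    {ν : ℝ} (hν : ν ∈ Set.Icc (0 : ℝ) 1) (hLt : L ν ≠ ∞) {k : ℕ} (hk : (2 : ℝ) ^ k ≤ 4 * r)
    {n : ℕ} (hn : 65536 * (S * r) ≤ n) {u : E}
    (hres : f ((P k).result G S) - f u ≤ ε / 2) (hδ : δ ≤ ε / 2) :
    f ((universal P S).point F G n) - f u ≤ ε := by
  have hν0 : 1 + ν ≠ 0 := by linarith [hν.1]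
  have h1 : ∀ x ∈ Q, F x ≤ f x := fun x hx => by
    have := ho.lower x hx x hx
    simp only [sub_self, map_zero, inner_zero_right] at this
    linarith
  have h2 : ∀ x ∈ Q, f x ≤ F x + δ := fun x hx => by
    have := ho.upper ν hν hLt x hx x hx
    simp only [sub_self, map_zero, inner_zero_right, Real.zero_rpow hν0] at this
    linarith
  have h2k : 0 < 2 ^ k := by positivity
  have hb : ∀ k, 0 < budget S k := fun k => Nat.succ_pos _
  have hlt : S * (8192 * 2 ^ k - 1) < budget S k := Nat.lt_succ_self _
  have hi : phaseStart (budget S) k + S * (8192 * 2 ^ k - 1) < n := by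
    have h3 := phaseStart_budget_le hS (k + 1)
    rw [phaseStart_succ] at h3
    -- `8192 * 2 * 4 = 65536`: phase length, geometric sum, and `2^k ≤ 4r`.
    have h4 : S * (8192 * 2 ^ (k + 1)) ≤ n := by
      have : ((S * (8192 * 2 ^ (k + 1)) : ℕ) : ℝ) ≤ n := by
        refine le_trans ?_ hn
        push_cast
        have : (S : ℝ) * 2 ^ k ≤ S * (4 * r) := by gcongr
        rw [pow_succ]
        linarith
      exact_mod_cast this
    omega
  have h3 := bestMethod_point_le (phasedQuery (fun k => (P k).next) (budget S)) G h1 h2 hi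
  have hN : 0 < (P k).steps := by rw [hPN]; omega
  rw [phasedQuery_answers _ hb F G k hlt, ← hPN k, ← hPS k, (P k).next_answers F G hN] at h3
  rw [hPS k] at h3
  change f ((universal P S).point F G n) ≤ _ at h3
  linarith

end Scheme

/-! ### Reading off the constants from the iteration counts -/

/-- The constants come from `T = 4096 * 2^k ≤ 16384 ρ` and `4194304 = 16384 * 256`. -/
theorem rpow_mul_le_of_le_div {T ρ δ ε p : ℝ} (hp : p ∈ Set.Icc (0 : ℝ) 1) (hρ : 1 ≤ ρ)
    (hε : 0 ≤ ε) (hT0 : 0 ≤ T) (hT : T ≤ 16384 * ρ) (hδ : 0 ≤ δ)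
    (h : ENNReal.ofReal δ ≤ ENNReal.ofReal (1 / 4194304 * ε) / ENNReal.ofReal ρ ^ p) :
    T ^ p * δ ≤ ε / 256 := by
  have hρ0 : 0 < ρ := by linarith
  have hρp : 0 < ρ ^ p := by positivity
  rw [ENNReal.ofReal_rpow_of_pos hρ0, ← ENNReal.ofReal_div_of_pos hρp,
    ENNReal.ofReal_le_ofReal_iff (by positivity), le_div_iff₀ hρp] at h
  have h1 : T ^ p ≤ 16384 * ρ ^ p := by
    refine (Real.rpow_le_rpow hT0 hT hp.1).trans ?_
    rw [Real.mul_rpow (by norm_num) hρ0.le]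
    refine mul_le_mul_of_nonneg_right ?_ hρp.le
    calc (16384 : ℝ) ^ p ≤ 16384 ^ (1 : ℝ) :=
          Real.rpow_le_rpow_of_exponent_le (by norm_num) hp.2
      _ = 16384 := Real.rpow_one _
  calc T ^ p * δ ≤ 16384 * ρ ^ p * δ := by gcongr
    _ = 16384 * (δ * ρ ^ p) := by ring
    _ ≤ _ := by linarith

theorem exists_two_pow {r : ℝ} (hr : 1 ≤ r) : ∃ k : ℕ, 2 * r ≤ 2 ^ k ∧ (2 : ℝ) ^ k ≤ 4 * r := by
  obtain ⟨n, h1, h2⟩ := exists_nat_pow_near (show (1 : ℝ) ≤ 2 * r by linarith) one_lt_two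
  exact ⟨n + 1, h2.le, by rw [pow_succ]; linarith⟩

/-- Solving for `l` gives `ε / R^(1+ν)` times a power of `G`; it is split so as to match
`holder_le_quadratic` with `a = ε/R²` and `b = ε`. -/
theorem le_of_rateConvex_le {l : ℝ≥0∞} {p ε R ν G : ℝ} (hp : 0 ≤ p) (hε : 0 < ε) (hR : 0 < R)
    (hν : ν ∈ Set.Icc (0 : ℝ) 1) (hG : 0 < G)
    (h : (l * ENNReal.ofReal (R ^ (1 + ν)) / ENNReal.ofReal ε) ^ (2 / (1 + 2 * p * ν + ν)) ≤
      ENNReal.ofReal G) :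
    l ≠ ∞ ∧ l.toReal ≤ (ε / R ^ 2) ^ ((1 + ν) / 2) * ε ^ ((1 - ν) / 2) *
      G ^ ((1 + 2 * p * ν + ν) / 2) := by
  have hpν : 0 ≤ p * ν := mul_nonneg hp hν.1
  have he : 0 < 1 + 2 * p * ν + ν := by nlinarith [hν.1]
  have hRν : 0 < R ^ (1 + ν) := by positivity
  have h1 := ENNReal.rpow_le_rpow h (show 0 ≤ (1 + 2 * p * ν + ν) / 2 by positivity)
  rw [← ENNReal.rpow_mul, div_mul_div_cancel₀' two_ne_zero, div_self he.ne', ENNReal.rpow_one,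
    ENNReal.ofReal_rpow_of_pos hG,
    ENNReal.div_le_iff (by simpa using hε) ENNReal.ofReal_ne_top,
    ← ENNReal.le_div_iff_mul_le (by left; simpa using hRν) (by left; exact ENNReal.ofReal_ne_top),
    ← ENNReal.ofReal_mul (by positivity), ← ENNReal.ofReal_div_of_pos hRν] at h1
  refine ⟨ne_top_of_le_ne_top ENNReal.ofReal_ne_top h1, ?_⟩
  refine (ENNReal.toReal_le_of_le_ofReal (by positivity) h1).trans (le_of_eq ?_)
  rw [Real.div_rpow hε.le (by positivity), ← Real.rpow_natCast_mul hR.le,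
    show ((2 : ℕ) : ℝ) * ((1 + ν) / 2) = 1 + ν by push_cast; ring, div_mul_eq_mul_div,
    ← Real.rpow_add hε, show (1 + ν) / 2 + (1 - ν) / 2 = 1 by ring, Real.rpow_one]
  ring

theorem le_of_rateStrong_le {l : ℝ≥0∞} {p ε μ ν G : ℝ} (hp : 0 ≤ p) (hε : 0 < ε) (hμ : 0 < μ)
    (hν : ν ∈ Set.Icc (0 : ℝ) 1) (hG : 0 < G)
    (h : (l ^ (2 / (1 + ν)) / ENNReal.ofReal (μ * ε ^ ((1 - ν) / (1 + ν)))) ^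
      ((1 + ν) / (1 + 2 * p * ν + ν)) ≤ ENNReal.ofReal G) :
    l ≠ ∞ ∧ l.toReal ≤ μ ^ ((1 + ν) / 2) * ε ^ ((1 - ν) / 2) *
      G ^ ((1 + 2 * p * ν + ν) / 2) := by
  have hpν : 0 ≤ p * ν := mul_nonneg hp hν.1
  have he : 0 < 1 + 2 * p * ν + ν := by nlinarith [hν.1]
  have hν0 : 0 < 1 + ν := by linarith [hν.1]
  have hμε : 0 < μ * ε ^ ((1 - ν) / (1 + ν)) := by positivity
  have h1 := ENNReal.rpow_le_rpow h (show 0 ≤ (1 + 2 * p * ν + ν) / (1 + ν) by positivity)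
  rw [← ENNReal.rpow_mul, div_mul_div_cancel₀' hν0.ne', div_self he.ne', ENNReal.rpow_one,
    ENNReal.ofReal_rpow_of_pos hG,
    ENNReal.div_le_iff (by simpa using hμε) ENNReal.ofReal_ne_top,
    ← ENNReal.ofReal_mul (by positivity)] at h1
  have h2 := ENNReal.rpow_le_rpow h1 (show 0 ≤ (1 + ν) / 2 by positivity)
  rw [← ENNReal.rpow_mul, show 2 / (1 + ν) * ((1 + ν) / 2) = 1 by field_simp, ENNReal.rpow_one,
    ENNReal.ofReal_rpow_of_pos (by positivity)] at h2
  refine ⟨ne_top_of_le_ne_top ENNReal.ofReal_ne_top h2, ?_⟩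
  refine (ENNReal.toReal_le_of_le_ofReal (by positivity) h2).trans (le_of_eq ?_)
  rw [Real.mul_rpow (by positivity) (by positivity), Real.mul_rpow hμ.le (by positivity),
    ← Real.rpow_mul hG.le, ← Real.rpow_mul hε.le, div_mul_div_cancel₀ hν0.ne',
    div_mul_div_cancel₀ hν0.ne']
  ring

theorem one_le_rateStrong {l : ℝ≥0∞} {p ε μ ν : ℝ} (hp : 0 ≤ p) (hε : 0 < ε) (hμ : 0 < μ)
    (hν : ν ∈ Set.Icc (0 : ℝ) 1)
    (h : ENNReal.ofReal (μ ^ ((1 + ν) / 2) * ε ^ ((1 - ν) / 2)) ≤ l) :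
    1 ≤ (l ^ (2 / (1 + ν)) / ENNReal.ofReal (μ * ε ^ ((1 - ν) / (1 + ν)))) ^
      ((1 + ν) / (1 + 2 * p * ν + ν)) := by
  have hpν : 0 ≤ p * ν := mul_nonneg hp hν.1
  have he : 0 < 1 + 2 * p * ν + ν := by nlinarith [hν.1]
  have hν0 : 0 < 1 + ν := by linarith [hν.1]
  have hμε : 0 < μ * ε ^ ((1 - ν) / (1 + ν)) := by positivity
  refine ENNReal.one_le_rpow ?_ (by positivity)
  rw [ENNReal.le_div_iff_mul_le (by left; simpa using hμε) (by left; exact ENNReal.ofReal_ne_top),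
    one_mul]
  refine le_trans (le_of_eq ?_) (ENNReal.rpow_le_rpow h (show 0 ≤ 2 / (1 + ν) by positivity))
  rw [ENNReal.ofReal_rpow_of_pos (by positivity), Real.mul_rpow (by positivity) (by positivity),
    ← Real.rpow_mul hμ.le, ← Real.rpow_mul hε.le,
    show (1 + ν) / 2 * (2 / (1 + ν)) = 1 by field_simp, Real.rpow_one,
    show (1 - ν) / 2 * (2 / (1 + ν)) = (1 - ν) / (1 + ν) by field_simp]

/-! ### Strongly convex problems -/

theorem le_of_forall_one_sub_mul_le {A B : ℝ} (h : ∀ t : ℝ, 0 < t → t ≤ 1 → (1 - t) * B ≤ A) :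
    B ≤ A := by
  refine le_of_forall_pos_le_add fun e he => ?_
  set t : ℝ := min 1 (e / (|B| + 1)) with ht
  have ht0 : 0 < t := by positivity
  have ht2 : t * (|B| + 1) ≤ e := by
    rw [← le_div_iff₀ (by positivity)]; exact min_le_right _ _
  have h1 := h t ht0 (min_le_left _ _)
  have h2 : t * B ≤ t * |B| := mul_le_mul_of_nonneg_left (le_abs_self B) ht0.le
  linarith

/-- Combine strong convexity on the segment with the subgradient inequality at a point near `x`,
divide by `t` and let `t → 0`. -/
theorem add_inner_add_sq_le {Q : Set E} {μ : ℝ} {f : E → ℝ} {f' : E → E}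
    (hs : StrongConvexOn Q μ f)
    (hf : ∀ x ∈ Q, ∀ y ∈ Q, f x + ⟪f' x, y - x⟫_ℝ ≤ f y) {x y : E} (hx : x ∈ Q) (hy : y ∈ Q) :
    f x + ⟪f' x, y - x⟫_ℝ + μ / 2 * ‖y - x‖ ^ 2 ≤ f y := by
  suffices μ / 2 * ‖y - x‖ ^ 2 ≤ f y - f x - ⟪f' x, y - x⟫_ℝ by linarith
  refine le_of_forall_one_sub_mul_le fun t ht0 ht1 => ?_
  have h1 := hs.2 hy hx ht0.le (sub_nonneg.2 ht1) (by ring)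
  have h2 := hf x hx _ (hs.1 hy hx ht0.le (sub_nonneg.2 ht1) (by ring))
  rw [show t • y + (1 - t) • x - x = t • (y - x) by module, inner_smul_right] at h2
  simp only [smul_eq_mul] at h1
  have h3 : t * ((1 - t) * (μ / 2 * ‖y - x‖ ^ 2)) ≤ t * (f y - f x - ⟪f' x, y - x⟫_ℝ) := by
    linarith
  exact le_of_mul_le_mul_left h3 ht0

/-- Adding the strong convexity inequalities at `x` and `y` gives `μ s² ≤ L_ν s^(1+ν)` for `s = ‖x -
y‖`, hence `L_ν ≥ μ s^(1-ν)` with `s² ≥ ε/μ`. -/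
theorem IsHolderProblem.rpow_mul_rpow_le {Q : Set E} {L : ℝ → ℝ≥0∞} {μ ε : ℝ} {f : E → ℝ}
    {f' : E → E} (h : IsHolderProblem (normSeminorm ℝ E) Q L f f') (hs : StrongConvexOn Q μ f)
    (hμ : 0 < μ) (hε : 0 < ε) {x y : E} (hx : x ∈ Q) (hy : y ∈ Q) (hxy : ε ≤ μ * ‖x - y‖ ^ 2)
    {ν : ℝ} (hν : ν ∈ Set.Icc (0 : ℝ) 1) :
    ENNReal.ofReal (μ ^ ((1 + ν) / 2) * ε ^ ((1 - ν) / 2)) ≤ L ν := by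
  by_cases hL : L ν = ∞
  · rw [hL]; exact le_top
  refine ENNReal.ofReal_le_of_le_toReal ?_
  set s := ‖x - y‖ with hs'
  have hs0 : 0 < s := by
    refine (norm_nonneg _).lt_of_ne fun h0 => ?_
    rw [hs', ← h0] at hxy
    linarith
  have h1 := add_inner_add_sq_le hs h.subgradient hx hy
  have h2 := add_inner_add_sq_le hs h.subgradient hy hx
  have h3 := inner_le_dualNorm_mul (normSeminorm ℝ E) one_pos
    (fun v => (one_mul ‖v‖).le) (f' x - f' y) (x - y)
  have h4 := h.holder ν hν hL x hx y hy
  rw [coe_normSeminorm, ← hs'] at h3 h4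
  rw [inner_sub_left] at h3
  rw [norm_sub_rev, ← neg_sub x y, inner_neg_right, ← hs'] at h1
  rw [← hs'] at h2
  have h5 : μ * s ^ 2 ≤ (L ν).toReal * s ^ ν * s := by
    have := mul_le_mul_of_nonneg_right h4 hs0.le
    linarith
  have h6 : μ * s ^ (1 - ν) ≤ (L ν).toReal := by
    have e : s ^ 2 = s ^ (1 - ν) * (s ^ ν * s) := by
      rw [← Real.rpow_add_one hs0.ne', ← Real.rpow_add hs0, ← Real.rpow_natCast]
      congr 1; push_cast; ring
    rw [e, ← mul_assoc, mul_assoc (L ν).toReal] at h5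
    exact le_of_mul_le_mul_right h5 (by positivity)
  refine le_trans ?_ h6
  have h7 : (ε / μ) ^ ((1 - ν) / 2) ≤ s ^ (1 - ν) := by
    have e : s ^ (1 - ν) = (s ^ 2) ^ ((1 - ν) / 2) := by
      rw [← Real.rpow_natCast_mul hs0.le]; congr 1; push_cast; ring
    rw [e]
    refine Real.rpow_le_rpow (by positivity) ?_ (by linarith [hν.2])
    rwa [div_le_iff₀' hμ]
  refine le_trans (le_of_eq ?_) (mul_le_mul_of_nonneg_left h7 hμ.le)
  rw [Real.div_rpow hε.le hμ.le, ← mul_div_assoc, mul_comm μ, mul_div_assoc, mul_comm]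
  congr 1
  nth_rw 2 [← Real.rpow_one μ]
  rw [← Real.rpow_sub hμ]
  congr 1
  ring

theorem exists_min_of_strongConvexOn [CompleteSpace E] {Q : Set E} {μ : ℝ} {f : E → ℝ}
    {f' : E → E} (hs : StrongConvexOn Q μ f) (hμ : 0 < μ)
    (hf : ∀ x ∈ Q, ∀ y ∈ Q, f x + ⟪f' x, y - x⟫_ℝ ≤ f y)
    (hne : Q.Nonempty) (hcl : IsClosed Q) (hb : Bornology.IsBounded Q) :
    ∃ z ∈ Q, ∀ x ∈ Q, f z + μ / 2 * ‖x - z‖ ^ 2 ≤ f x := by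
  have hs' : StronglyConvex (normSeminorm ℝ E) Q μ f := by
    intro x hx y hy a b ha hb hab
    have h := hs.2 hx hy ha hb hab
    simp only [smul_eq_mul] at h
    rw [coe_normSeminorm]
    linarith
  -- `f` has a continuous affine minorant touching it at each point of `Q`.
  have hl : LowerSemicontinuousOn f Q := by
    intro x hx c hc
    have hcont : Continuous fun u : E => f x + ⟪f' x, u - x⟫_ℝ := by fun_prop
    have h1 : ∀ᶠ u in nhdsWithin x Q, c < f x + ⟪f' x, u - x⟫_ℝ :=
      hcont.continuousWithinAt.eventually_const_lt (by simpa using hc)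
    filter_upwards [h1, self_mem_nhdsWithin] with u hu huQ
    exact hu.trans_le (hf x hx u huQ)
  obtain ⟨z, hz, h⟩ := hs'.exists_min hμ hl hne hcl hs.1 hb one_pos fun v => (one_mul ‖v‖).le
  exact ⟨z, hz, h⟩

/-! ### The universal methods -/

theorem ofReal_toReal_rate {x : ℝ≥0∞} {C : ℝ} (hC : 0 < C) {n : ℕ} (h1 : 1 ≤ x)
    (h : ENNReal.ofReal C * x ≤ n) :
    x ≠ ∞ ∧ 1 ≤ x.toReal ∧ C * x.toReal ≤ n := by
  have hx : x ≠ ∞ := by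
    rintro rfl
    rw [ENNReal.mul_top (by simpa using hC)] at h
    exact absurd h (by simp)
  refine ⟨hx, ?_, ?_⟩
  · simpa using ENNReal.toReal_mono hx h1
  · have := ENNReal.toReal_mono (ENNReal.natCast_ne_top n) h
    rwa [ENNReal.toReal_mul, ENNReal.toReal_ofReal hC.le, ENNReal.toReal_natCast] at this

theorem exists_method_convex [CompleteSpace E] {Q : Set E} (hne : Q.Nonempty) (hcl : IsClosed Q)
    (hQ : Convex ℝ Q) (hb : Bornology.IsBounded Q) {nrm : Seminorm ℝ E} {d : E → ℝ} {a : ℝ}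
    (ha : 0 < a) (hn : ∀ x, a * ‖x‖ ≤ nrm x) (hd : IsProxFunction nrm Q d) {p ε : ℝ}
    (hp : p ∈ Set.Icc (0 : ℝ) 1) (hε : 0 < ε) :
    ∃ M : Method Q, ∀ (L : ℝ → ℝ≥0∞) (δ : ℝ) (f : E → ℝ) (f' : E → E) (F : E → ℝ) (G : E → E),
      IsHolderProblem nrm Q L f f' → 0 ≤ δ → IsInexactOracle nrm Q 0 δ L f F G →
      ENNReal.ofReal δ ≤ ENNReal.ofReal (1 / 4194304 * ε) / rateConvex p ε (proxDiam Q d) L ^ p →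
      ∀ n : ℕ, ENNReal.ofReal 65536 * rateConvex p ε (proxDiam Q d) L ≤ n →
      ∀ y ∈ Q, f (M.point F G n) - f y ≤ ε := by
  obtain ⟨z, hz, hzd⟩ := hd.exists_center hne hcl hQ hb ha hn
  set R := proxDiam Q d with hR
  have hR0 : 0 ≤ R := Real.sqrt_nonneg _
  rcases hR0.eq_or_lt with h0 | hRpos
  · have hsub : ∀ u ∈ Q, u = z := fun u hu => by
      have h1 := (hzd u hu).2.2
      have h2 := hn (u - z)
      have h3 : nrm (u - z) = 0 := by
        rw [← h0] at h1
        exact pow_eq_zero_iff two_ne_zero |>.1 (le_antisymm (by linarith) (by positivity))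
      rw [h3] at h2
      rw [← sub_eq_zero, ← norm_le_zero_iff]
      nlinarith [norm_nonneg (u - z)]
    refine ⟨⟨fun _ => ⟨z, hz⟩, fun _ => ⟨z, hz⟩⟩, ?_⟩
    intro L δ f f' F G _ _ _ _ n _ y hy
    rw [hsub y hy]
    simpa [Method.point] using hε.le
  have hP : ∀ k : ℕ, ∃ P : Scheme Q,
      P.IsProx nrm (fun _ => d) (ε / R ^ 2 * (4096 * 2 ^ k : ℝ) ^ (1 + p) / 64) ∧ P.p = p ∧
      P.steps = 8192 * 2 ^ k - 1 ∧ P.stages = 1 := fun k =>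
    Scheme.exists_isProx (fun _ => hd) hne hcl hQ hb ha hn (by positivity) _ _ _
  choose P hPprox hPp hPN hPS using hP
  refine ⟨Scheme.universal P 1, ?_⟩
  intro L δ f f' F G hf hδ ho hδr n hnr y hy
  have hrate1 : 1 ≤ rateConvex p ε R L := le_max_left _ _
  obtain ⟨hfin, hr1, hrn⟩ := ofReal_toReal_rate (by norm_num) hrate1 hnr
  set r := (rateConvex p ε R L).toReal with hr
  have hrr : rateConvex p ε R L = ENNReal.ofReal r := (ENNReal.ofReal_toReal hfin).symm
  obtain ⟨k, hk1, hk2⟩ := exists_two_pow hr1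
  -- The infimum need not be attained; `2^k ≥ 2r` makes the inequality strict, so some `ν` lies
  -- below `2^k`.
  have hlt : (⨅ ν ∈ Set.Icc (0 : ℝ) 1, (L ν * ENNReal.ofReal (R ^ (1 + ν)) / ENNReal.ofReal ε) ^
      (2 / (1 + 2 * p * ν + ν))) < ENNReal.ofReal (2 ^ k) := by
    refine lt_of_le_of_lt ((le_max_right 1 _).trans hrr.le) ?_
    rw [ENNReal.ofReal_lt_ofReal_iff (by positivity)]
    linarith
  simp only [iInf_lt_iff] at hlt
  obtain ⟨ν, hν, hlt⟩ := hlt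
  obtain ⟨hLt, hL⟩ := le_of_rateConvex_le hp.1 hε hRpos hν (by positivity) hlt.le
  rw [hrr] at hδr
  have hTδ := rpow_mul_le_of_le_div (T := 4096 * 2 ^ k) hp hr1 hε.le (by positivity)
    (by linarith) hδ hδr
  have hδ2 : δ ≤ ε / 2 := by
    have hT1 : (1 : ℝ) ≤ (4096 * 2 ^ k : ℝ) ^ p := by
      refine Real.one_le_rpow ?_ hp.1
      linarith
    nlinarith
  refine Scheme.universal_sub_le one_pos hPS hPN ho hν hLt hk2 (by simpa using hrn) ?_ hδ2
  have h1 := (P k).stage_sub_le_of_oracle hQ (d := fun _ => d) (m := d z) (a := ε / R ^ 2) (b := ε)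
    le_rfl (by positivity) hε.le (by rwa [hPp]) (hPN k) hδ (by rw [hPp]; exact hPprox k)
    hf.subgradient ho hν hLt (by rwa [hPp]) (by rwa [hPp]) (c := (P k).start)
    (fun u hu => by linarith [(hzd u hu).1]) hy
  change f ((P k).stage G (P k).start (P k).steps).avg - f y ≤ _
  refine h1.trans ?_
  have h2 : ε / R ^ 2 * (d y - d z) ≤ ε / R ^ 2 * R ^ 2 :=
    mul_le_mul_of_nonneg_left (hzd y hy).2.1 (by positivity)
  rw [div_mul_cancel₀ _ (by positivity)] at h2
  linarith

theorem le_exp_ceil_log {w ε : ℝ} (hε : 0 < ε) (hw : 0 ≤ w) :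
    w ≤ ε * 3 ^ (max 1 ⌈Real.log (w / ε)⌉₊) := by
  set S := max 1 ⌈Real.log (w / ε)⌉₊ with hS
  rcases hw.eq_or_lt with rfl | hw
  · positivity
  have h1 : Real.log (w / ε) ≤ S :=
    (Nat.le_ceil _).trans (by exact_mod_cast le_max_right _ _)
  have h2 : w / ε ≤ Real.exp S := by
    rwa [← Real.log_le_iff_le_exp (by positivity)]
  have h3 : Real.exp S ≤ 3 ^ S := by
    rw [← Real.exp_one_pow]
    exact pow_le_pow_left₀ (Real.exp_pos 1).le (by linarith [Real.exp_one_lt_d9]) _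
  rw [div_le_iff₀' hε] at h2
  exact h2.trans (by gcongr)

-- The number of stages may depend on `Q`, `μ` and `ε` but not on `f`. Choosing it by the diameter
-- of `Q` ensures that `S` times the per-stage rate stays below the total rate.
set_option maxHeartbeats 1000000 in
theorem exists_method_strong [CompleteSpace E] {Q : Set E} (hne : Q.Nonempty) (hcl : IsClosed Q)
    (hQ : Convex ℝ Q) (hb : Bornology.IsBounded Q) (x₀ : E) {p ε μ : ℝ}
    (hp : p ∈ Set.Icc (0 : ℝ) 1) (hε : 0 < ε) (hμ : 0 < μ) :
    ∃ M : Method Q, ∀ (L : ℝ → ℝ≥0∞) (δ : ℝ) (f : E → ℝ) (f' : E → E) (F : E → ℝ) (G : E → E),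
      StrongConvexOn Q μ f → IsHolderProblem (normSeminorm ℝ E) Q L f f' → 0 ≤ δ →
      IsInexactOracle (normSeminorm ℝ E) Q μ δ L f F G →
      ENNReal.ofReal δ ≤ ENNReal.ofReal (1 / 4194304 * ε) /
        rateStrong p ε μ (proxDiam Q (euclideanProx x₀)) L ^ p →
      ∀ n : ℕ, ENNReal.ofReal 65536 *
        rateStrong p ε μ (proxDiam Q (euclideanProx x₀)) L ≤ n →
      ∀ y ∈ Q, f (M.point F G n) - f y ≤ ε := by
  obtain ⟨z, hz, hzd⟩ := (isProxFunction_euclideanProx hb x₀).exists_center hne hcl hQ hb one_pos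
    (fun v => (one_mul ‖v‖).le)
  set R := proxDiam Q (euclideanProx x₀) with hR
  set Sₗ : ℕ := max 1 ⌈Real.log (μ * R ^ 2 / ε)⌉₊ with hSₗ
  -- the number of stages
  obtain ⟨S, hS0, hSdiam, hScase⟩ : ∃ S : ℕ, 0 < S ∧
      (∀ x ∈ Q, ∀ y ∈ Q, μ * ‖x - y‖ ^ 2 ≤ 8 * ε * 3 ^ S) ∧
      (S = 1 ∨ S = Sₗ ∧ ∃ x ∈ Q, ∃ y ∈ Q, ε ≤ μ * ‖x - y‖ ^ 2) := by
    by_cases hsmall : ∀ x ∈ Q, ∀ y ∈ Q, μ * ‖x - y‖ ^ 2 ≤ ε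
    · exact ⟨1, one_pos, fun x hx y hy => by linarith [hsmall x hx y hy], Or.inl rfl⟩
    · push Not at hsmall
      obtain ⟨x, hx, y, hy, hxy⟩ := hsmall
      refine ⟨Sₗ, lt_of_lt_of_le one_pos (le_max_left _ _), fun v hv w hw => ?_,
        Or.inr ⟨rfl, x, hx, y, hy, hxy.le⟩⟩
      have h1 := le_exp_ceil_log hε (show 0 ≤ μ * R ^ 2 by positivity)
      have h2 := (hzd v hv).2.2
      have h3 := (hzd w hw).2.2
      rw [coe_normSeminorm] at h2 h3
      have h4 : ‖v - w‖ ≤ ‖v - z‖ + ‖w - z‖ := by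
        rw [show v - w = (v - z) - (w - z) by abel]; exact norm_sub_le _ _
      -- `‖v - w‖² ≤ 2(‖v - z‖² + ‖w - z‖²)`, and each square is at most `2R²`.
      have h5 : ‖v - w‖ ^ 2 ≤ 8 * R ^ 2 := by
        have : ‖v - w‖ ^ 2 ≤ (‖v - z‖ + ‖w - z‖) ^ 2 := by gcongr
        nlinarith [sq_nonneg (‖v - z‖ - ‖w - z‖)]
      have h6 := mul_le_mul_of_nonneg_left h5 hμ.le
      linarith
  have hP : ∀ k : ℕ, ∃ P : Scheme Q,
      P.IsProx (normSeminorm ℝ E) (fun c => euclideanProx c)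
        (μ * (4096 * 2 ^ k : ℝ) ^ (1 + p) / 64) ∧ P.p = p ∧
      P.steps = 8192 * 2 ^ k - 1 ∧ P.stages = S := fun k =>
    Scheme.exists_isProx (fun c => isProxFunction_euclideanProx hb c) hne hcl hQ hb one_pos
      (fun v => (one_mul ‖v‖).le) (by positivity) _ _ _
  choose P hPprox hPp hPN hPS using hP
  refine ⟨Scheme.universal P S, ?_⟩
  intro L δ f f' F G hs hf hδ ho hδr n hnr y hy
  have hrate1 : 1 ≤ rateStrong p ε μ R L := le_max_left _ _
  obtain ⟨hfin, hρ1, hρn⟩ := ofReal_toReal_rate (by norm_num) hrate1 hnr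
  set ρ := (rateStrong p ε μ R L).toReal with hρ
  have hρρ : rateStrong p ε μ R L = ENNReal.ofReal ρ := (ENNReal.ofReal_toReal hfin).symm
  set X : ℝ≥0∞ := ⨅ ν ∈ Set.Icc (0 : ℝ) 1,
    (L ν ^ (2 / (1 + ν)) / ENNReal.ofReal (μ * ε ^ ((1 - ν) / (1 + ν)))) ^
      ((1 + ν) / (1 + 2 * p * ν + ν)) with hX
  have hXρ : X * (Sₗ : ℝ≥0∞) ≤ ENNReal.ofReal ρ := by
    rw [← hρρ, rateStrong]
    exact le_max_right _ _
  have hSₗ1 : 1 ≤ Sₗ := le_max_left _ _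
  have hXle : X ≤ X * (Sₗ : ℝ≥0∞) := le_mul_of_one_le_right' (by exact_mod_cast hSₗ1)
  -- `r` is the rate of one stage. For several stages it is the infimum `X` itself, which is
  -- admissible only because `X ≥ 1`.
  obtain ⟨r, hr1, hSr, hXr⟩ : ∃ r : ℝ, 1 ≤ r ∧ S * r ≤ ρ ∧ X ≤ ENNReal.ofReal r := by
    rcases hScase with h1 | ⟨h1, v, hv, w, hw, hvw⟩
    · exact ⟨ρ, hρ1, by simp [h1], hXle.trans hXρ⟩
    · have hX1 : 1 ≤ X := le_iInf₂ fun ν hν =>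
        one_le_rateStrong hp.1 hε hμ hν (hf.rpow_mul_rpow_le hs hμ hε hv hw hvw hν)
      have hXt : X ≠ ∞ := ne_top_of_le_ne_top ENNReal.ofReal_ne_top (hXle.trans hXρ)
      refine ⟨X.toReal, by simpa using ENNReal.toReal_mono hXt hX1, ?_,
        (ENNReal.ofReal_toReal hXt).ge⟩
      have := ENNReal.toReal_mono ENNReal.ofReal_ne_top hXρ
      rw [ENNReal.toReal_mul, ENNReal.toReal_ofReal (zero_le_one.trans hρ1),
        ENNReal.toReal_natCast] at this
      rwa [h1, mul_comm]
  have hrρ : r ≤ ρ := by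
    have : (1 : ℝ) ≤ S := by exact_mod_cast hS0
    nlinarith
  obtain ⟨k, hk1, hk2⟩ := exists_two_pow hr1
  have hlt : X < ENNReal.ofReal (2 ^ k) := by
    refine lt_of_le_of_lt hXr ?_
    rw [ENNReal.ofReal_lt_ofReal_iff (by positivity)]
    linarith
  simp only [hX, iInf_lt_iff] at hlt
  obtain ⟨ν, hν, hlt⟩ := hlt
  obtain ⟨hLt, hL⟩ := le_of_rateStrong_le hp.1 hε hμ hν (by positivity) hlt.le
  rw [hρρ] at hδr
  have hTδ := rpow_mul_le_of_le_div (T := 4096 * 2 ^ k) hp hρ1 hε.le (by positivity)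
    (by linarith) hδ hδr
  have hδ2 : δ ≤ ε / 2 := by
    have hT1 : (1 : ℝ) ≤ (4096 * 2 ^ k : ℝ) ^ p := by
      refine Real.one_le_rpow ?_ hp.1
      linarith
    nlinarith
  refine Scheme.universal_sub_le hS0 hPS hPN ho hν hLt hk2 (by linarith) ?_ hδ2
  obtain ⟨u, hu, hmin⟩ := exists_min_of_strongConvexOn hs hμ hf.subgradient hne hcl hb
  have hstage : ∀ c : Q, f ((P k).stage G c (P k).steps).avg - f u ≤
      μ / 2 * ‖(c : E) - u‖ ^ 2 / 64 + 3 * ε / 128 := by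
    intro c
    have h1 := (P k).stage_sub_le_of_oracle hQ (d := fun c => euclideanProx c) (m := 0)
      (a := μ) (b := ε) hμ.le hμ.le hε.le (by rwa [hPp]) (hPN k) hδ (by rw [hPp]; exact hPprox k)
      hf.subgradient ho hν hLt (by rwa [hPp]) (by rwa [hPp]) (c := c)
      (fun u hu => by unfold euclideanProx; positivity) hu
    rw [euclideanProx, norm_sub_rev] at h1
    linarith
  -- The recursion `V ↦ V/64 + 3ε/128` starts below `4 ε 3^S` and keeps the additive part below
  -- `ε/4`; after `S` stages `(3/64)^S` beats the initial factor.
  have hconv : ∀ j : ℕ, μ / 2 * ‖((P k).result G j : E) - u‖ ^ 2 ≤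
        4 * ε * 3 ^ S / 64 ^ j + ε / 4 ∧
      (0 < j → f ((P k).result G j) - f u ≤ 4 * ε * 3 ^ S / 64 ^ j + ε / 4) := by
    intro j
    induction j with
    | zero =>
      refine ⟨?_, fun h => absurd h (lt_irrefl _)⟩
      have := hSdiam _ ((P k).result G 0).2 u hu
      rw [pow_zero, div_one]
      linarith
    | succ j ih =>
      have h1 := hstage ((P k).result G j)
      have h2 : f ((P k).result G (j + 1)) - f u ≤ 4 * ε * 3 ^ S / 64 ^ (j + 1) + ε / 4 := by
        change f ((P k).stage G ((P k).result G j) (P k).steps).avg - f u ≤ _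
        rw [pow_succ, ← div_div]
        linarith [ih.1]
      exact ⟨by linarith [hmin _ ((P k).result G (j + 1)).2], fun _ => h2⟩
  have h1 := (hconv S).2 hS0
  have h2 : 4 * ε * 3 ^ S / 64 ^ S ≤ ε / 4 := by
    rw [mul_div_assoc, ← div_pow]
    have : (3 / 64 : ℝ) ^ S ≤ (3 / 64) ^ 1 :=
      pow_le_pow_of_le_one (by norm_num) (by norm_num) hS0
    nlinarith
  have h3 : f u ≤ f y := by
    have := hmin y hy
    have : 0 ≤ μ / 2 * ‖y - u‖ ^ 2 := by positivity
    linarith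
  linarith

end UniversalMethods

end

theorem mainTheorem2 :
    ∃ C c : ℝ, 0 < C ∧ 0 < c ∧
      ∀ (E : Type*) [NormedAddCommGroup E] [InnerProductSpace ℝ E] [CompleteSpace E]
        (Q : Set E), Q.Nonempty → IsClosed Q → Convex ℝ Q → Bornology.IsBounded Q →
        -- convex problems, general prox-structure
        (∀ (nrm : Seminorm ℝ E) (d : E → ℝ),
          (∃ a : ℝ, 0 < a ∧ ∀ x, a * ‖x‖ ≤ nrm x) →
          UniversalMethods.IsProxFunction nrm Q d →
          ∃ M : (p ε : ℝ) → UniversalMethods.Method Q,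
            ∀ p ∈ Set.Icc (0 : ℝ) 1, ∀ ε : ℝ, 0 < ε →
            ∀ (L : ℝ → ENNReal) (δ : ℝ) (f : E → ℝ) (f' : E → E) (F : E → ℝ) (G : E → E),
              UniversalMethods.IsHolderProblem nrm Q L f f' →
              0 ≤ δ →
              UniversalMethods.IsInexactOracle nrm Q 0 δ L f F G →
              ENNReal.ofReal δ ≤ ENNReal.ofReal (c * ε) /
                UniversalMethods.rateConvex p ε (UniversalMethods.proxDiam Q d) L ^ p →
              ∀ n : ℕ,
                ENNReal.ofReal C *
                  UniversalMethods.rateConvex p ε (UniversalMethods.proxDiam Q d) L ≤ n →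
                ∀ y ∈ Q, f ((M p ε).point F G n) - f y ≤ ε) ∧
        -- strongly convex problems, Euclidean prox-structure
        (∀ x₀ : E,
          ∃ M : (p ε μ : ℝ) → UniversalMethods.Method Q,
            ∀ p ∈ Set.Icc (0 : ℝ) 1, ∀ ε : ℝ, 0 < ε → ∀ μ : ℝ, 0 < μ →
            ∀ (L : ℝ → ENNReal) (δ : ℝ) (f : E → ℝ) (f' : E → E) (F : E → ℝ) (G : E → E),
              StrongConvexOn Q μ f →
              UniversalMethods.IsHolderProblem (normSeminorm ℝ E) Q L f f' →
              0 ≤ δ →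
              UniversalMethods.IsInexactOracle (normSeminorm ℝ E) Q μ δ L f F G →
              ENNReal.ofReal δ ≤ ENNReal.ofReal (c * ε) /
                UniversalMethods.rateStrong p ε μ
                  (UniversalMethods.proxDiam Q (UniversalMethods.euclideanProx x₀)) L ^ p →
              ∀ n : ℕ,
                ENNReal.ofReal C *
                  UniversalMethods.rateStrong p ε μ
                    (UniversalMethods.proxDiam Q (UniversalMethods.euclideanProx x₀)) L ≤ n →
                ∀ y ∈ Q, f ((M p ε μ).point F G n) - f y ≤ ε) := by
  refine ⟨65536, 1 / 4194304, by norm_num, by norm_num, ?_⟩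
  intro E _ _ _ Q hne hcl hQ hb
  refine ⟨fun nrm d hn hd => ?_, fun x₀ => ?_⟩
  · obtain ⟨a, ha, hn⟩ := hn
    -- Outside the admissible parameter range a constant method serves as a dummy value.
    have h : ∀ p ε : ℝ, ∃ M : UniversalMethods.Method Q, p ∈ Set.Icc (0 : ℝ) 1 → 0 < ε → _ :=
      fun p ε => by
        by_cases hpe : p ∈ Set.Icc (0 : ℝ) 1 ∧ 0 < ε
        · obtain ⟨M, hM⟩ := UniversalMethods.exists_method_convex hne hcl hQ hb ha hn hd hpe.1 hpe.2
          exact ⟨M, fun _ _ => hM⟩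
        · obtain ⟨x, hx⟩ := hne
          exact ⟨⟨fun _ => ⟨x, hx⟩, fun _ => ⟨x, hx⟩⟩, fun h1 h2 => absurd ⟨h1, h2⟩ hpe⟩
    choose M hM using h
    exact ⟨M, fun p hp ε hε => hM p ε hp hε⟩
  · have h : ∀ p ε μ : ℝ, ∃ M : UniversalMethods.Method Q,
        p ∈ Set.Icc (0 : ℝ) 1 → 0 < ε → 0 < μ → _ := fun p ε μ => by
      by_cases hpe : p ∈ Set.Icc (0 : ℝ) 1 ∧ 0 < ε ∧ 0 < μ
      · obtain ⟨M, hM⟩ := UniversalMethods.exists_method_strong hne hcl hQ hb x₀ hpe.1 hpe.2.1 hpe.2.2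
        exact ⟨M, fun _ _ _ => hM⟩
      · obtain ⟨x, hx⟩ := hne
        exact ⟨⟨fun _ => ⟨x, hx⟩, fun _ => ⟨x, hx⟩⟩, fun h1 h2 h3 => absurd ⟨h1, h2, h3⟩ hpe⟩
    choose M hM using h
    exact ⟨M, fun p hp ε hε μ hμ => hM p ε μ hp hε hμ⟩
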